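/- Let $M$ be a smooth (Hausdorff, second countable) manifold of dimension $n+2$, $n\ge 0$, with a smooth Lorentzian metric $g$ of signature $(-,+,\dots,+)$, and let $\mathcal F$ be a smooth codimension-one foliation of $M$ which is - lightlike: for every $x\in M$ the restriction of $g_x$ to $T_x\mathcal F$ is degenerate; and - totally geodesic: for every geodesic $\gamma$ of $g$ defined near $0$ with $\gamma'(0)\in T_{\gamma(0)}\mathcal F$, the point $\gamma(t)$ lies in the leaf of $\mathcal F$ through $\gamma(0)$ for all $t$ close to $0$. Then every point $p\in M$ lies in the domain of a smooth coordinate chart $(u,v,x^1,\dots,x^n)$ of $M$ adapted to $\mathcal F$ (a foliation chart whose plaques are the level sets of $u$) in which $$g=2\,du\,dv+H(u,v,x)\,du^2+\sum_{i=1}^n W_i(u,v,x)\,du\,dx^i+\sum_{i,j=1}^n h_{ij}(u,x)\,dx^i\,dx^j$$ for smooth functions $H$, $W_i$ and $h_{ij}=h_{ji}$ (that is, $g(w,w)$ is given by this quadratic expression for every tangent vector $w$). In particular the leafwise metric coefficients $h_{ij}$ do not depend on $v$. -/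

import Mathlib

open Set Filter Topology
open scoped Manifold ContDiff

/-- A smooth Lorentzian metric (signature `(-, +, …, +)`) on a smooth manifold of
dimension `n + 2`. -/
structure LorentzMetric (n : ℕ) (M : Type*) [TopologicalSpace M]
    [ChartedSpace (EuclideanSpace ℝ (Fin (n + 2))) M] [IsManifold (𝓡 (n + 2)) ∞ M] where
  /-- The bilinear form on each tangent space. -/
  val (x : M) : TangentSpace (𝓡 (n + 2)) x →L[ℝ] TangentSpace (𝓡 (n + 2)) x →L[ℝ] ℝ
  symm (x : M) (v w : TangentSpace (𝓡 (n + 2)) x) : val x v w = val x w v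
  contMDiff : ContMDiff (𝓡 (n + 2)) ((𝓡 (n + 2)).prod
      𝓘(ℝ, EuclideanSpace ℝ (Fin (n + 2)) →L[ℝ] EuclideanSpace ℝ (Fin (n + 2)) →L[ℝ] ℝ)) ∞
    (fun x ↦ Bundle.TotalSpace.mk'
      (EuclideanSpace ℝ (Fin (n + 2)) →L[ℝ] EuclideanSpace ℝ (Fin (n + 2)) →L[ℝ] ℝ) x (val x))
  exists_orthonormal (x : M) :
    ∃ b : Module.Basis (Fin (n + 2)) ℝ (TangentSpace (𝓡 (n + 2)) x), ∀ i j,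
      val x (b i) (b j) = if i = j then (if i = 0 then -1 else 1) else 0

section Coordinates

variable {n : ℕ} {M : Type*} [TopologicalSpace M]
  [ChartedSpace (EuclideanSpace ℝ (Fin (n + 2))) M]

/-- The differential at `y` of the coordinate map `φ`; its `i`-th entry on the tangent
vector `w` is `dφⁱ(w)`. -/
noncomputable def chartDiff (φ : OpenPartialHomeomorph M (EuclideanSpace ℝ (Fin (n + 2))))
    (y : M) (w : TangentSpace (𝓡 (n + 2)) y) : EuclideanSpace ℝ (Fin (n + 2)) :=
  mfderiv (𝓡 (n + 2)) (𝓡 (n + 2)) φ y w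

/-- Two charts have locally the same plaques (the plaques of a chart being the level sets of
its `0`-th coordinate): near each common point, the change of coordinates maps level sets of the
`0`-th coordinate to level sets of the `0`-th coordinate, i.e. has the form
`(u, z) ↦ (f u, k (u, z))`, and so has its inverse. -/
def PlaqueCompatible (φ ψ : OpenPartialHomeomorph M (EuclideanSpace ℝ (Fin (n + 2)))) : Prop :=
  ∀ x ∈ φ.source ∩ ψ.source, ∃ U ∈ 𝓝 x, ∀ y ∈ U, ∀ z ∈ U, φ y 0 = φ z 0 ↔ ψ y 0 = ψ z 0

end Coordinates

/-- A smooth codimension one foliation of `M`, given by a foliation atlas: a family of smooth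
charts covering `M`, with pairwise locally matching plaques.  The plaques
(level sets of the `0`-th coordinate in the domain of a chart) are connected, as usual. -/
structure CodimOneFoliation (n : ℕ) (M : Type*) [TopologicalSpace M]
    [ChartedSpace (EuclideanSpace ℝ (Fin (n + 2))) M] where
  atlas : Set (OpenPartialHomeomorph M (EuclideanSpace ℝ (Fin (n + 2))))
  subset_maximalAtlas : atlas ⊆ IsManifold.maximalAtlas (𝓡 (n + 2)) ∞ M
  cover (x : M) : ∃ φ ∈ atlas, x ∈ φ.source
  isPreconnected_plaque : ∀ φ ∈ atlas, ∀ c : ℝ, IsPreconnected {y | y ∈ φ.source ∧ φ y 0 = c}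
  compatible : ∀ φ ∈ atlas, ∀ ψ ∈ atlas, PlaqueCompatible φ ψ

namespace CodimOneFoliation

variable {n : ℕ} {M : Type*} [TopologicalSpace M]
  [ChartedSpace (EuclideanSpace ℝ (Fin (n + 2))) M]

/-- `y` and `z` lie in a common plaque of the foliation atlas. -/
def SamePlaque (F : CodimOneFoliation n M) (y z : M) : Prop :=
  ∃ φ ∈ F.atlas, y ∈ φ.source ∧ z ∈ φ.source ∧ φ y 0 = φ z 0

/-- The leaf through `x`: all points joined to `x` by a finite chain of plaques. -/
def leaf (F : CodimOneFoliation n M) (x : M) : Set M :=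
  {y | Relation.ReflTransGen F.SamePlaque x y}

/-- The tangent space at `x` to the leaf through `x`: the kernel of the differential of the
transverse coordinate of the foliation charts at `x` (they all have the same kernel). -/
def tangentSpace (F : CodimOneFoliation n M) (x : M) : Set (TangentSpace (𝓡 (n + 2)) x) :=
  {w | ∀ φ ∈ F.atlas, x ∈ φ.source → chartDiff φ x w 0 = 0}

/-- A chart of `M` adapted to the foliation: a member of the maximal foliation atlas, so that
its level sets `{φ⁰ = c}` are plaques of the foliation. -/
structure IsAdaptedChart (F : CodimOneFoliation n M)
    (φ : OpenPartialHomeomorph M (EuclideanSpace ℝ (Fin (n + 2)))) : Prop where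
  mem_maximalAtlas : φ ∈ IsManifold.maximalAtlas (𝓡 (n + 2)) ∞ M
  isPreconnected_plaque : ∀ c : ℝ, IsPreconnected {y | y ∈ φ.source ∧ φ y 0 = c}
  compatible : ∀ ψ ∈ F.atlas, PlaqueCompatible φ ψ

end CodimOneFoliation

section Geometry

variable {n : ℕ} {M : Type*} [TopologicalSpace M]
  [ChartedSpace (EuclideanSpace ℝ (Fin (n + 2))) M] [IsManifold (𝓡 (n + 2)) ∞ M]

namespace LorentzMetric

/-- The metric in the coordinates `φ`: its value at the coordinate point `z` on two coordinate
vectors, `∑ g_ij(z) vⁱ wʲ`. -/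
noncomputable def inChart (g : LorentzMetric n M)
    (φ : OpenPartialHomeomorph M (EuclideanSpace ℝ (Fin (n + 2))))
    (z v w : EuclideanSpace ℝ (Fin (n + 2))) : ℝ :=
  g.val (φ.symm z) (mfderiv (𝓡 (n + 2)) (𝓡 (n + 2)) φ.symm z v)
    (mfderiv (𝓡 (n + 2)) (𝓡 (n + 2)) φ.symm z w)

/-- The geodesic equation of the Levi-Civita connection for a coordinate curve `c` in the chart
`φ` at time `t`, with the free index lowered:
`g_kl c̈ᵏ + (∂_i g_jl - ½ ∂_l g_ij) ċⁱ ċʲ = 0` for all `l`, the second term being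
`Γ_{l,ij} ċⁱ ċʲ` with the Christoffel symbols of the first kind. As `g` is nondegenerate, this is
`c̈ᵏ + Γᵏ_ij ċⁱ ċʲ = 0`. -/
def GeodesicEqInChart (g : LorentzMetric n M)
    (φ : OpenPartialHomeomorph M (EuclideanSpace ℝ (Fin (n + 2))))
    (c : ℝ → EuclideanSpace ℝ (Fin (n + 2))) (t : ℝ) : Prop :=
  ∀ w : EuclideanSpace ℝ (Fin (n + 2)),
    g.inChart φ (c t) (deriv (deriv c) t) w
      + fderiv ℝ (fun z ↦ g.inChart φ z (deriv c t) w) (c t) (deriv c t)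
      - 1 / 2 * fderiv ℝ (fun z ↦ g.inChart φ z (deriv c t) (deriv c t)) (c t) w = 0

/-- `γ` is a geodesic of `g` on the open set `s` of times: it is `C²` and satisfies the geodesic
equation at every time in some smooth chart (equivalently, in every smooth chart, since the
equation is invariant under changes of coordinates). -/
def IsGeodesicOn (g : LorentzMetric n M) (γ : ℝ → M) (s : Set ℝ) : Prop :=
  ContMDiffOn 𝓘(ℝ, ℝ) (𝓡 (n + 2)) 2 γ s ∧
  ∀ t ∈ s, ∃ φ ∈ IsManifold.maximalAtlas (𝓡 (n + 2)) ∞ M, γ t ∈ φ.source ∧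
    g.GeodesicEqInChart φ (φ ∘ γ) t

end LorentzMetric

namespace CodimOneFoliation

/-- The foliation is lightlike: the metric is degenerate on each tangent space to the leaves. -/
def IsLightlike (F : CodimOneFoliation n M) (g : LorentzMetric n M) : Prop :=
  ∀ x : M, ∃ w ∈ F.tangentSpace x, w ≠ 0 ∧ ∀ w' ∈ F.tangentSpace x, g.val x w w' = 0

/-- The foliation is totally geodesic: a geodesic defined near time `0` whose velocity at time
`0` is tangent to the leaf through its position stays in that leaf for all small times. -/
def IsTotallyGeodesic (F : CodimOneFoliation n M) (g : LorentzMetric n M) : Prop :=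
  ∀ (γ : ℝ → M) (ε : ℝ), 0 < ε → g.IsGeodesicOn γ (Ioo (-ε) ε) →
    (mfderiv 𝓘(ℝ, ℝ) (𝓡 (n + 2)) γ 0 (1 : ℝ) : TangentSpace (𝓡 (n + 2)) (γ 0))
      ∈ F.tangentSpace (γ 0) →
    ∀ᶠ t in 𝓝 (0 : ℝ), γ t ∈ F.leaf (γ 0)

end CodimOneFoliation

end Geometry

/-- Splitting of `ℝⁿ⁺²` as coordinates `(u, v, x¹, …, xⁿ)`. -/
def uvx {n : ℕ} (z : EuclideanSpace ℝ (Fin (n + 2))) : ℝ × ℝ × (Fin n → ℝ) :=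
  (z 0, z 1, fun i ↦ z i.succ.succ)

/-- The coordinates `(u, x¹, …, xⁿ)` of a point of `ℝⁿ⁺²`. -/
def ux {n : ℕ} (z : EuclideanSpace ℝ (Fin (n + 2))) : ℝ × (Fin n → ℝ) :=
  (z 0, fun i ↦ z i.succ.succ)

/-!
Fix a foliation chart `φ` at `p`, let `u` be its transverse coordinate and let `N` be the metric
gradient of `u`, so that `g(N, ·) = du`. A degenerate direction of the restriction of `g` to a leaf
is orthogonal to the leaf, hence a multiple of `N`; so for a lightlike foliation `N` is tangent to
the leaves (`CodimOneFoliation.IsLightlike.gradient_tangent`).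

A geodesic tangent to a leaf stays in the leaf, and therefore in a plaque: the leaf meets the chart
in countably many plaques (`CodimOneFoliation.transversallyCountable_leaf`), and a continuous
function with countably many values is constant. So `u` is constant along the geodesic, its second
derivative vanishes, and pairing the geodesic equation with `N` gives
`(∂_w g)(w, N) = ½ (∂_N g)(w, w)` for the initial velocity `w`. Together with the derivative of
`g(w, N) = du(w)` along `w` this says `(L_N g)(w, w) = 0` for all `w` tangent to the leaves
(`killing_of_geodesic`, `CodimOneFoliation.IsTotallyGeodesic.killing`).

Since `du(N) = 0` and `N ≠ 0`, there are coordinates `(u, v, x)` with the same `u`, up to a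
constant, and `N = ∂_v` (`exists_flowBox`). In these, `g(∂_v, ·) = du` gives the coefficients
`g_vu = 1`, `g_vv = g_vx = 0`, and the Killing equation gives `∂_v h_ij = 0`
(`exists_normalForm`).

The straightening theorem needs a flow that depends smoothly on the initial condition
(`exists_contDiffOn_flow`). With time rescaled to `[-1, 1]`, the integral curve of `τ f` from `x`
is the solution `γ` of `γ - τ ∫₀ f ∘ γ = x` in the Banach space `C([-1, 1], E)`. The left hand side
is a smooth function of `(τ, γ)`, because superposition with a smooth map is smooth there
(`contDiff_superposition`), and its derivative in `γ` is the identity at `τ = 0`; so the inverse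
function theorem applies.
-/

/-! ### Smooth dependence of integral curves on the initial condition -/

section Flow

universe u

/-- The bounded bilinear map `(A, γ) ↦ (s ↦ A s (γ s))` on continuous functions on a compact
space. -/
noncomputable def pointwiseApply (K : Type*) [TopologicalSpace K] [CompactSpace K]
    (E F : Type*) [NormedAddCommGroup E] [NormedSpace ℝ E]
    [NormedAddCommGroup F] [NormedSpace ℝ F] :
    C(K, E →L[ℝ] F) →L[ℝ] C(K, E) →L[ℝ] C(K, F) :=
  LinearMap.mkContinuous₂
    (LinearMap.mk₂ ℝ
      (fun (A : C(K, E →L[ℝ] F)) (γ : C(K, E)) ↦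
        (⟨fun s ↦ A s (γ s), A.continuous.clm_apply γ.continuous⟩ : C(K, F)))
      (fun A B γ ↦ by ext s; simp) (fun c A γ ↦ by ext s; simp)
      (fun A γ η ↦ by ext s; simp) (fun c A γ ↦ by ext s; simp)) 1
    (fun A γ ↦ by
      rw [ContinuousMap.norm_le _ (by positivity)]
      intro s
      have h1 := (A s).le_opNorm (γ s)
      have h2 := A.norm_coe_le_norm s
      have h3 := γ.norm_coe_le_norm s
      calc ‖A s (γ s)‖ ≤ ‖A s‖ * ‖γ s‖ := h1
        _ ≤ ‖A‖ * ‖γ‖ := by gcongr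
        _ = 1 * ‖A‖ * ‖γ‖ := by ring)

@[simp]
theorem pointwiseApply_apply {K : Type*} [TopologicalSpace K] [CompactSpace K]
    {E F : Type*} [NormedAddCommGroup E] [NormedSpace ℝ E]
    [NormedAddCommGroup F] [NormedSpace ℝ F] (A : C(K, E →L[ℝ] F)) (γ : C(K, E)) (s : K) :
    pointwiseApply K E F A γ s = A s (γ s) := rfl

/-- Superposition `γ ↦ f ∘ γ` with a `C¹` map is differentiable on continuous functions on a
compact space, and its derivative is pointwise application of the derivative of `f`. -/
theorem hasFDerivAt_superposition {K : Type*} [TopologicalSpace K] [CompactSpace K]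
    {E F : Type*} [NormedAddCommGroup E] [NormedSpace ℝ E]
    [NormedAddCommGroup F] [NormedSpace ℝ F] (f : C(E, F)) (f' : C(E, E →L[ℝ] F))
    (hf : ∀ x, HasFDerivAt f (f' x) x) (γ : C(K, E)) :
    HasFDerivAt (fun γ : C(K, E) ↦ f.comp γ) (pointwiseApply K E F (f'.comp γ)) γ := by
  rw [hasFDerivAt_iff_isLittleO, Asymptotics.isLittleO_iff]
  intro c hc
  have hcont := (ContinuousMap.continuous_postcomp (X := K) f').continuousAt (x := γ)
  obtain ⟨δ, hδ, h⟩ := (Metric.continuousAt_iff (α := C(K, E)) (β := C(K, E →L[ℝ] F))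
    (f := f'.comp) (a := γ)).1 hcont c hc
  filter_upwards [Metric.ball_mem_nhds γ hδ] with η hη
  rw [ContinuousMap.norm_le _ (by positivity)]
  intro s
  have key : ‖f (η s) - f (γ s) - f' (γ s) (η s - γ s)‖ ≤ c * ‖η s - γ s‖ := by
    refine Convex.norm_image_sub_le_of_norm_hasFDerivWithin_le' (s := segment ℝ (γ s) (η s))
      (fun x _ ↦ (hf x).hasFDerivWithinAt) ?_ (convex_segment _ _)
      (left_mem_segment _ _ _) (right_mem_segment _ _ _)
    intro x hx
    rw [segment_eq_image'] at hx
    obtain ⟨θ, hθ, rfl⟩ := hx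
    -- a point of the segment is the value at `s` of a curve close to `γ`
    have hd : dist (γ + θ • (η - γ)) γ < δ := by
      rw [dist_eq_norm, add_sub_cancel_left, norm_smul, Real.norm_of_nonneg hθ.1]
      rw [Metric.mem_ball, dist_eq_norm] at hη
      nlinarith [norm_nonneg (η - γ), hθ.2]
    have h1 := (h hd).le
    have h2 := (ContinuousMap.dist_le hc.le).1 h1 s
    rw [dist_eq_norm] at h2
    simpa using h2
  refine le_trans ?_ (key.trans ?_)
  · simp
  · gcongr
    exact (η - γ).norm_coe_le_norm s

/-- Superposition with a smooth map is smooth on continuous functions on a compact space. -/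
theorem contDiff_superposition {K : Type*} [TopologicalSpace K] [CompactSpace K]
    {E F : Type u} [NormedAddCommGroup E] [NormedSpace ℝ E]
    [NormedAddCommGroup F] [NormedSpace ℝ F] (f : C(E, F)) (hf : ContDiff ℝ ∞ f) :
    ContDiff ℝ ∞ (fun γ : C(K, E) ↦ f.comp γ) := by
  rw [contDiff_infty]
  intro n
  induction n generalizing F with
  | zero => exact contDiff_zero.2 (ContinuousMap.continuous_postcomp f)
  | succ n ih =>
    have hf' : ContDiff ℝ ∞ (fderiv ℝ f) := (contDiff_infty_iff_fderiv.1 hf).2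
    let f' : C(E, E →L[ℝ] F) := ⟨fderiv ℝ f, hf'.continuous⟩
    push_cast
    rw [contDiff_succ_iff_hasFDerivAt]
    refine ⟨fun γ ↦ pointwiseApply K E F (f'.comp γ), ?_, fun γ ↦ ?_⟩
    · exact (pointwiseApply K E F).contDiff.comp (ih f' hf')
    · exact hasFDerivAt_superposition f f'
        (fun x ↦ ((hf.differentiable (by simp)) x).hasFDerivAt) γ

variable {E : Type u} [NormedAddCommGroup E] [NormedSpace ℝ E]

/-- The operator `γ ↦ (s ↦ ∫₀ˢ γ)` on continuous curves `[-1, 1] → E`. -/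
noncomputable def integralOp (E : Type*) [NormedAddCommGroup E] [NormedSpace ℝ E] :
    C(Icc (-1 : ℝ) 1, E) →L[ℝ] C(Icc (-1 : ℝ) 1, E) :=
  LinearMap.mkContinuous
    { toFun := fun γ ↦ ⟨fun s ↦ ∫ t in (0 : ℝ)..s, IccExtend (by norm_num) γ t,
        (intervalIntegral.continuous_primitive
          (fun a b ↦ (γ.continuous.Icc_extend' (h := by norm_num)).intervalIntegrable a b) 0).comp
          continuous_subtype_val⟩
      map_add' := fun γ η ↦ by
        ext s
        simp only [ContinuousMap.coe_mk, ContinuousMap.add_apply]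
        rw [← intervalIntegral.integral_add
          ((γ.continuous.Icc_extend' (h := by norm_num)).intervalIntegrable _ _)
          ((η.continuous.Icc_extend' (h := by norm_num)).intervalIntegrable _ _)]
        rfl
      map_smul' := fun c γ ↦ by
        ext s
        simp only [ContinuousMap.coe_mk, ContinuousMap.smul_apply, RingHom.id_apply]
        rw [← intervalIntegral.integral_smul]
        rfl } 1
    (fun γ ↦ by
      rw [ContinuousMap.norm_le _ (by positivity)]
      intro s
      have h := intervalIntegral.norm_integral_le_of_norm_le_const (a := (0 : ℝ)) (b := s)
        (f := IccExtend (by norm_num) γ) (C := ‖γ‖)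
        (fun t _ ↦ γ.norm_coe_le_norm _)
      refine h.trans ?_
      have : |(s : ℝ) - 0| ≤ 1 := by rw [sub_zero]; exact abs_le.2 s.2
      rw [one_mul]
      exact mul_le_of_le_one_right (norm_nonneg _) this)

theorem integralOp_apply (γ : C(Icc (-1 : ℝ) 1, E)) (s : Icc (-1 : ℝ) 1) :
    integralOp E γ s = ∫ t in (0 : ℝ)..s, IccExtend (by norm_num) γ t := rfl

/-- If `η` is `γ` run `r` times as fast, then so are the primitives, up to the factor `r`. -/
theorem integralOp_rescale (γ η : C(Icc (-1 : ℝ) 1, E)) {r : ℝ}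
    (h : ∀ t ∈ Icc (-1 : ℝ) 1, IccExtend (by norm_num) η t = IccExtend (by norm_num) γ (r * t))
    (s : Icc (-1 : ℝ) 1) (rs : Icc (-1 : ℝ) 1) (hrs : (rs : ℝ) = r * s) :
    integralOp E γ rs = r • integralOp E η s := by
  rw [integralOp_apply, integralOp_apply, hrs]
  have : ∫ t in (0 : ℝ)..s, IccExtend (by norm_num) η t
      = ∫ t in (0 : ℝ)..s, IccExtend (by norm_num) γ (r * t) := by
    refine intervalIntegral.integral_congr fun t ht ↦ h t ?_
    have h0 : (0 : ℝ) ∈ Icc (-1 : ℝ) 1 := by constructor <;> norm_num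
    exact (ordConnected_Icc.uIcc_subset h0 s.2) ht
  rw [this, intervalIntegral.smul_integral_comp_mul_left, mul_zero]

/-- The map `(τ, γ) ↦ (τ, γ - τ ∫₀ f ∘ γ)` on `ℝ × C([-1, 1], E)`. Its preimage of `(τ, const x)`
is the integral curve of `τ f` starting at `x`. -/
noncomputable def integralEq (f : C(E, E)) (a : ℝ × C(Icc (-1 : ℝ) 1, E)) :
    ℝ × C(Icc (-1 : ℝ) 1, E) :=
  (a.1, a.2 - a.1 • integralOp E (f.comp a.2))

theorem contDiff_integralEq (f : C(E, E)) (hf : ContDiff ℝ ∞ f) :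
    ContDiff ℝ ∞ (integralEq f) := by
  have h1 : ContDiff ℝ ∞ (fun γ : C(Icc (-1 : ℝ) 1, E) ↦ f.comp γ) := contDiff_superposition f hf
  exact contDiff_fst.prodMk (contDiff_snd.sub (contDiff_fst.smul
    ((integralOp E).contDiff.comp (h1.comp contDiff_snd))))

/-- The shear `(τ, γ) ↦ (τ, γ - τ w)`. -/
noncomputable def shear {X : Type*} [NormedAddCommGroup X] [NormedSpace ℝ X] (w : X) :
    (ℝ × X) ≃L[ℝ] (ℝ × X) :=
  ContinuousLinearEquiv.equivOfInverse
    ((ContinuousLinearMap.fst ℝ ℝ X).prod (ContinuousLinearMap.snd ℝ ℝ X -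
      (ContinuousLinearMap.fst ℝ ℝ X).smulRight w))
    ((ContinuousLinearMap.fst ℝ ℝ X).prod (ContinuousLinearMap.snd ℝ ℝ X +
      (ContinuousLinearMap.fst ℝ ℝ X).smulRight w))
    (fun a ↦ by ext <;> simp) (fun a ↦ by ext <;> simp)

/-- At time parameter `0` the derivative of `integralEq` is a shear, hence invertible. -/
theorem hasFDerivAt_integralEq (f : C(E, E)) (hf : ContDiff ℝ ∞ f) (γ : C(Icc (-1 : ℝ) 1, E)) :
    HasFDerivAt (integralEq f) (shear (integralOp E (f.comp γ)) :
      (ℝ × C(Icc (-1 : ℝ) 1, E)) →L[ℝ] (ℝ × C(Icc (-1 : ℝ) 1, E))) ((0 : ℝ), γ) := by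
  have h1 : ContDiff ℝ ∞ (fun γ : C(Icc (-1 : ℝ) 1, E) ↦ f.comp γ) := contDiff_superposition f hf
  have h2 : ContDiff ℝ ∞ (fun a : ℝ × C(Icc (-1 : ℝ) 1, E) ↦ integralOp E (f.comp a.2)) :=
    (integralOp E).contDiff.comp (h1.comp contDiff_snd)
  have h3 := ((h2.differentiable (by simp)) ((0 : ℝ), γ)).hasFDerivAt
  have h4 := (hasFDerivAt_fst (𝕜 := ℝ) (p := ((0 : ℝ), γ))).prodMk
    ((hasFDerivAt_snd (𝕜 := ℝ) (p := ((0 : ℝ), γ))).sub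
      ((hasFDerivAt_fst (𝕜 := ℝ) (p := ((0 : ℝ), γ))).smul h3))
  refine HasFDerivAt.congr_fderiv h4 (ContinuousLinearMap.ext fun v ↦ Prod.ext ?_ ?_)
  · simp [shear]
  · simp [shear]

/-- **Smooth local flow** of a smooth vector field on a Banach space. The integral curves solve
`integralEq f (τ, γ) = (τ, const x)`, so that they depend smoothly on `(τ, x)` by the inverse
function theorem. -/
theorem exists_contDiffOn_flow [CompleteSpace E] (f : E → E) (hf : ContDiff ℝ ∞ f) (p : E) :
    ∃ ε > 0, ∃ Θ : ℝ × E → E, ContDiffOn ℝ ∞ Θ (Ioo (-ε) ε ×ˢ Metric.ball p ε) ∧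
      ∀ x ∈ Metric.ball p ε, Θ (0, x) = x ∧
        ∀ t ∈ Ioo (-ε) ε, HasDerivAt (fun t ↦ Θ (t, x)) (f (Θ (t, x))) t := by
  set fC : C(E, E) := ⟨f, hf.continuous⟩
  have hΦ := contDiff_integralEq fC hf
  set Φ := integralEq fC with hΦdef
  let c0 : C(Icc (-1 : ℝ) 1, E) := ContinuousMap.const _ p
  have hd : HasFDerivAt Φ _ ((0 : ℝ), c0) := hasFDerivAt_integralEq fC hf c0
  let e := hΦ.contDiffAt.toOpenPartialHomeomorph Φ hd (by simp)
  have he : ⇑e = Φ := ContDiffAt.toOpenPartialHomeomorph_coe _ _ _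
  have hes : ((0 : ℝ), c0) ∈ e.source := ContDiffAt.mem_toOpenPartialHomeomorph_source _ _ _
  have hΦ0 : Φ ((0 : ℝ), c0) = ((0 : ℝ), c0) := by simp [hΦdef, integralEq]
  have het : ((0 : ℝ), c0) ∈ e.target := by
    have := e.map_source hes
    rwa [he, hΦ0] at this
  have hinv : ∀ᶠ a in 𝓝 ((0 : ℝ), c0), fderiv ℝ Φ a ∈
      range ((↑) : ((ℝ × C(Icc (-1 : ℝ) 1, E)) ≃L[ℝ] (ℝ × C(Icc (-1 : ℝ) 1, E))) →
        ((ℝ × C(Icc (-1 : ℝ) 1, E)) →L[ℝ] (ℝ × C(Icc (-1 : ℝ) 1, E)))) := by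
    refine (hΦ.continuous_fderiv (by simp)).continuousAt.eventually_mem ?_
    rw [hd.fderiv]
    exact ContinuousLinearEquiv.nhds _
  obtain ⟨ρ, hρ, hball⟩ := Metric.mem_nhds_iff.1
    (inter_mem (e.open_source.mem_nhds hes) hinv)
  let j : ℝ × E → ℝ × C(Icc (-1 : ℝ) 1, E) := fun q ↦ (q.1, ContinuousMap.const _ q.2)
  have hconst : ContDiff ℝ ∞ (fun x : E ↦ ContinuousMap.const (Icc (-1 : ℝ) 1) x) :=
    (ContinuousLinearMap.const ℝ (Icc (-1 : ℝ) 1) : E →L[ℝ] C(Icc (-1 : ℝ) 1, E)).contDiff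
  have hj : ContDiff ℝ ∞ j := contDiff_fst.prodMk (hconst.comp contDiff_snd)
  have hV : e.target ∩ e.symm ⁻¹' Metric.ball ((0 : ℝ), c0) ρ ∈ 𝓝 (j (0, p)) := by
    refine (e.symm.isOpen_inter_preimage Metric.isOpen_ball).mem_nhds ⟨het, ?_⟩
    have : e.symm (Φ ((0 : ℝ), c0)) = ((0 : ℝ), c0) := by rw [← he]; exact e.left_inv hes
    rw [hΦ0] at this
    change e.symm ((0 : ℝ), c0) ∈ Metric.ball ((0 : ℝ), c0) ρ
    rw [this]
    exact Metric.mem_ball_self hρ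
  obtain ⟨ε, hε, hεV⟩ := Metric.mem_nhds_iff.1 (hj.continuous.continuousAt.preimage_mem_nhds hV)
  have hbox : ∀ t ∈ Ioo (-ε) ε, ∀ x ∈ Metric.ball p ε,
      j (t, x) ∈ e.target ∧ e.symm (j (t, x)) ∈ Metric.ball ((0 : ℝ), c0) ρ := by
    intro t ht x hx
    refine hεV ?_
    rw [← ball_prod_same]
    refine ⟨?_, hx⟩
    rw [Real.ball_eq_Ioo]
    simpa using ht
  let Γ : ℝ × E → C(Icc (-1 : ℝ) 1, E) := fun q ↦ (e.symm (j q)).2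
  let one : Icc (-1 : ℝ) 1 := ⟨1, by norm_num⟩
  have hsol : ∀ t ∈ Ioo (-ε) ε, ∀ x ∈ Metric.ball p ε, e.symm (j (t, x)) = (t, Γ (t, x)) ∧
      Γ (t, x) - t • integralOp E (fC.comp (Γ (t, x))) = ContinuousMap.const _ x := by
    intro t ht x hx
    have h := e.right_inv (hbox t ht x hx).1
    rw [he] at h
    have h1 : (e.symm (j (t, x))).1 = t := congrArg Prod.fst h
    have h2 := congrArg Prod.snd h
    refine ⟨Prod.ext h1 rfl, ?_⟩
    simpa [hΦdef, integralEq, h1, j] using h2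
  have hext : ∀ (η : C(Icc (-1 : ℝ) 1, E)) (t : ℝ) (ht : t ∈ Icc (-1 : ℝ) 1),
      IccExtend (by norm_num) η t = η ⟨t, ht⟩ := fun η t ht ↦ IccExtend_of_mem _ _ ht
  have hmul : ∀ r ∈ Icc (-1 : ℝ) 1, ∀ s ∈ Icc (-1 : ℝ) 1, r * s ∈ Icc (-1 : ℝ) 1 := by
    intro r hr s hs
    refine abs_le.1 ?_
    rw [abs_mul]
    exact mul_le_one₀ (abs_le.2 hr) (abs_nonneg _) (abs_le.2 hs)
  -- uniqueness in the inverse function theorem applied to the rescaled curve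
  have hresc : ∀ t ∈ Ioo (-ε) ε, ∀ x ∈ Metric.ball p ε, ∀ r (hr : r ∈ Icc (-1 : ℝ) 1),
      Γ (r * t, x) one = Γ (t, x) ⟨r, hr⟩ := by
    intro t ht x hx r hr
    obtain ⟨h1, h2⟩ := hsol t ht x hx
    have hb := (hbox t ht x hx).2
    rw [h1, ← ball_prod_same] at hb
    let η : C(Icc (-1 : ℝ) 1, E) :=
      (Γ (t, x)).comp ⟨fun s ↦ ⟨r * s, hmul r hr s s.2⟩, by fun_prop⟩
    have hrt : |r * t| ≤ |t| := by
      rw [abs_mul]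
      exact mul_le_of_le_one_left (abs_nonneg _) (abs_le.2 hr)
    have hηball : (r * t, η) ∈ Metric.ball ((0 : ℝ), c0) ρ := by
      rw [← ball_prod_same]
      refine ⟨?_, ?_⟩
      · have := hb.1
        rw [mem_ball_zero_iff, Real.norm_eq_abs] at this ⊢
        exact hrt.trans_lt this
      · refine lt_of_le_of_lt ?_ (Metric.mem_ball.1 hb.2)
        rw [ContinuousMap.dist_le dist_nonneg]
        intro s
        exact ContinuousMap.dist_apply_le_dist (f := Γ (t, x)) (g := c0) ⟨r * s, hmul r hr s s.2⟩
    have hΦη : Φ (r * t, η) = j (r * t, x) := by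
      refine Prod.ext rfl ?_
      ext s
      have h3 := integralOp_rescale (fC.comp (Γ (t, x))) (fC.comp η) (r := r)
        (fun t' ht' ↦ by
          rw [hext _ _ ht', hext _ _ (hmul r hr t' ht')]; rfl)
        s ⟨r * s, hmul r hr s s.2⟩ rfl
      have h4 := congrArg (fun γ : C(Icc (-1 : ℝ) 1, E) ↦ γ ⟨r * s, hmul r hr s s.2⟩) h2
      simp only [ContinuousMap.sub_apply, ContinuousMap.smul_apply, h3] at h4
      change η s - (r * t) • integralOp E (fC.comp η) s = x
      rw [mul_comm r t, mul_smul]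
      exact h4
    have h5 := e.left_inv (hball hηball).1
    rw [he, hΦη] at h5
    change (e.symm (j (r * t, x))).2 one = _
    rw [h5]
    change Γ (t, x) ⟨r * (1 : ℝ), _⟩ = _
    congr 1
    exact Subtype.ext (mul_one r)
  refine ⟨ε, hε, fun q ↦ Γ q one, ?_, fun x hx ↦ ⟨?_, fun t₀ ht₀ ↦ ?_⟩⟩
  · rintro ⟨t, x⟩ ⟨ht, hx⟩
    obtain ⟨h1, h2⟩ := hbox t ht x hx
    obtain ⟨L, hL⟩ := (hball h2).2
    have h3 : ContDiffAt ℝ ∞ e.symm (j (t, x)) := by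
      refine e.contDiffAt_symm (f₀' := L) h1 ?_ ?_
      · rw [hL, he]
        exact ((hΦ.differentiable (by simp)) _).hasFDerivAt
      · rw [he]
        exact hΦ.contDiffAt
    have h4 : ContDiffAt ℝ ∞ Γ (t, x) := (h3.comp (t, x) hj.contDiffAt).snd
    exact ((ContinuousMap.evalCLM ℝ one).contDiff.contDiffAt.comp (t, x) h4).contDiffWithinAt
  · obtain ⟨-, h2⟩ := hsol 0 ⟨by linarith, hε⟩ x hx
    rw [zero_smul, sub_zero] at h2
    change Γ (0, x) one = x
    rw [h2]
    rfl
  · obtain ⟨τ, hτ1, hτ2⟩ := exists_between (abs_lt.2 ht₀)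
    have hτ : 0 < τ := (abs_nonneg _).trans_lt hτ1
    have hτmem : τ ∈ Ioo (-ε) ε := ⟨by linarith, hτ2⟩
    have hdiv : ∀ t, |t| < τ → t / τ ∈ Icc (-1 : ℝ) 1 := by
      intro t ht
      refine abs_le.1 ?_
      rw [abs_div, abs_of_pos hτ]
      exact (div_le_one hτ).2 ht.le
    set k : ℝ → E := IccExtend (by norm_num : (-1 : ℝ) ≤ 1) (fC.comp (Γ (τ, x))) with hk
    have hkc : Continuous k := (ContinuousMap.continuous _).Icc_extend'
    have hval : ∀ t, |t| < τ → Γ (t, x) one = x + τ • ∫ s in (0 : ℝ)..(t / τ), k s := by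
      intro t ht
      have h1 := hresc τ hτmem x hx (t / τ) (hdiv t ht)
      rw [div_mul_cancel₀ _ hτ.ne'] at h1
      have h2 := congrArg (fun γ : C(Icc (-1 : ℝ) 1, E) ↦ γ ⟨t / τ, hdiv t ht⟩)
        (hsol τ hτmem x hx).2
      simp only [ContinuousMap.sub_apply, ContinuousMap.smul_apply, integralOp_apply,
        ContinuousMap.const_apply] at h2
      rw [h1]
      exact sub_eq_iff_eq_add.1 h2
    have hev : (fun t ↦ Γ (t, x) one) =ᶠ[𝓝 t₀] fun t ↦ x + τ • ∫ s in (0 : ℝ)..(t / τ), k s := by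
      filter_upwards [(continuous_abs.tendsto t₀).eventually (gt_mem_nhds hτ1)] with t ht
      exact hval t ht
    have hder : HasDerivAt (fun t ↦ x + τ • ∫ s in (0 : ℝ)..(t / τ), k s) (k (t₀ / τ)) t₀ := by
      have h1 : HasDerivAt (fun u ↦ ∫ s in (0 : ℝ)..u, k s) (k (t₀ / τ)) (t₀ / τ) :=
        intervalIntegral.integral_hasDerivAt_right (hkc.intervalIntegrable _ _)
          (hkc.stronglyMeasurableAtFilter _ _) hkc.continuousAt
      have h2 := (h1.scomp t₀ ((hasDerivAt_id t₀).div_const τ)).const_smul τ |>.const_add x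
      rw [smul_smul, mul_one_div_cancel hτ.ne', one_smul] at h2
      exact h2
    have hk0 : k (t₀ / τ) = f (Γ (t₀, x) one) := by
      have h1 := hresc τ hτmem x hx (t₀ / τ) (hdiv t₀ hτ1)
      rw [div_mul_cancel₀ _ hτ.ne'] at h1
      rw [hk, hext _ _ (hdiv t₀ hτ1), h1]
      rfl
    rw [← hk0]
    exact hder.congr_of_eventuallyEq hev

end Flow

/-! ### Leaves meet each foliation chart in countably many plaques -/

namespace CodimOneFoliation

variable {n : ℕ} {M : Type*} [TopologicalSpace M]
  [ChartedSpace (EuclideanSpace ℝ (Fin (n + 2))) M]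

/-- A set is transversally countable if it meets only countably many plaques of each foliation
chart. -/
def TransversallyCountable (F : CodimOneFoliation n M) (S : Set M) : Prop :=
  ∀ φ ∈ F.atlas, ((fun y ↦ φ y 0) '' (S ∩ φ.source)).Countable

theorem transversallyCountable_singleton (F : CodimOneFoliation n M) (x : M) :
    F.TransversallyCountable {x} := fun _ _ ↦
  ((countable_singleton x).mono inter_subset_left).image _

/-- On a plaque of `ψ` the transverse coordinate of `φ` is locally constant, hence takes countably
many values, as plaques are Lindelöf. -/
theorem transversallyCountable_plaque [SecondCountableTopology M] (F : CodimOneFoliation n M)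
    {ψ : OpenPartialHomeomorph M (EuclideanSpace ℝ (Fin (n + 2)))} (hψ : ψ ∈ F.atlas) (c : ℝ) :
    F.TransversallyCountable {y | y ∈ ψ.source ∧ ψ y 0 = c} := by
  intro φ hφ
  have h := F.compatible φ hφ ψ hψ
  choose! U hU hUc using h
  obtain ⟨t, hts, htc, hcov⟩ := TopologicalSpace.countable_cover_nhdsWithin
    (s := {y | y ∈ ψ.source ∧ ψ y 0 = c} ∩ φ.source) (f := U)
    (fun x hx ↦ mem_nhdsWithin_of_mem_nhds (hU x ⟨hx.2, hx.1.1⟩))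
  refine (htc.image (fun y ↦ φ y 0)).mono ?_
  rintro _ ⟨y, hy, rfl⟩
  obtain ⟨x, hxt, hyx⟩ := mem_iUnion₂.1 (hcov hy)
  have hx := hts hxt
  have hx' : x ∈ φ.source ∩ ψ.source := ⟨hx.2, hx.1.1⟩
  refine ⟨x, hxt, ?_⟩
  exact (hUc x hx' x (mem_of_mem_nhds (hU x hx')) y hyx).2 (hx.1.2.trans hy.1.2.symm)

theorem transversallyCountable_iUnion (F : CodimOneFoliation n M) {ι : Type*} [Countable ι]
    {S : ι → Set M} (h : ∀ i, F.TransversallyCountable (S i)) :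
    F.TransversallyCountable (⋃ i, S i) := by
  intro φ hφ
  rw [iUnion_inter, image_iUnion]
  exact countable_iUnion fun i ↦ h i φ hφ

theorem TransversallyCountable.mono {F : CodimOneFoliation n M} {S T : Set M}
    (h : F.TransversallyCountable T) (hST : S ⊆ T) : F.TransversallyCountable S :=
  fun φ hφ ↦ (h φ hφ).mono (image_mono (inter_subset_inter_left _ hST))

/-- Since plaques are connected, a chain of plaques can be replaced by a chain of plaques of
charts from any prescribed covering subfamily of the atlas. -/
theorem SamePlaque.reflTransGen {F : CodimOneFoliation n M}
    {A : Set (OpenPartialHomeomorph M (EuclideanSpace ℝ (Fin (n + 2))))} (hA : A ⊆ F.atlas)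
    (hcov : ∀ x, ∃ φ ∈ A, x ∈ φ.source) {y z : M} (h : F.SamePlaque y z) :
    Relation.ReflTransGen
      (fun y z ↦ ∃ φ ∈ A, y ∈ φ.source ∧ z ∈ φ.source ∧ φ y 0 = φ z 0) y z := by
  obtain ⟨ψ, hψ, hy, hz, hyz⟩ := h
  refine (F.isPreconnected_plaque ψ hψ (ψ y 0)).induction₂'
    (Relation.ReflTransGen (fun y z ↦ ∃ φ ∈ A, y ∈ φ.source ∧ z ∈ φ.source ∧ φ y 0 = φ z 0))
    ?_ (fun _ _ _ _ _ _ h1 h2 ↦ h1.trans h2) ⟨hy, rfl⟩ ⟨hz, hyz.symm⟩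
  rintro x ⟨hx, hxc⟩
  obtain ⟨φ, hφ, hxφ⟩ := hcov x
  obtain ⟨U, hU, hUc⟩ := F.compatible φ (hA hφ) ψ hψ x ⟨hxφ, hx⟩
  filter_upwards [mem_nhdsWithin_of_mem_nhds hU,
    mem_nhdsWithin_of_mem_nhds (φ.open_source.mem_nhds hxφ), self_mem_nhdsWithin] with w hwU hw hwQ
  have heq : φ x 0 = φ w 0 :=
    (hUc x (mem_of_mem_nhds hU) w hwU).2 (hxc.trans hwQ.2.symm)
  exact ⟨.single ⟨φ, hφ, hxφ, hw, heq⟩, .single ⟨φ, hφ, hw, hxφ, heq.symm⟩⟩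

theorem transversallyCountable_leaf [SecondCountableTopology M] (F : CodimOneFoliation n M)
    (x : M) : F.TransversallyCountable (F.leaf x) := by
  choose χ hχ hχs using F.cover
  obtain ⟨s, hs, hsU⟩ := TopologicalSpace.countable_cover_nhds
    (fun x ↦ (χ x).open_source.mem_nhds (hχs x))
  set A := χ '' s with hA
  have hAF : A ⊆ F.atlas := by
    rintro _ ⟨y, -, rfl⟩
    exact hχ y
  have hAc : Countable A := (hs.image χ).to_subtype
  have hcov : ∀ x, ∃ φ ∈ A, x ∈ φ.source := by
    intro x
    obtain ⟨y, hy, hxy⟩ := mem_iUnion₂.1 (hsU.symm ▸ mem_univ x)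
    exact ⟨χ y, mem_image_of_mem _ hy, hxy⟩
  set R : M → M → Prop :=
    fun y z ↦ ∃ φ ∈ A, y ∈ φ.source ∧ z ∈ φ.source ∧ φ y 0 = φ z 0
  let sat : Set M → Set M := fun S ↦ {z | ∃ y ∈ S, R y z}
  have hsat : ∀ S, F.TransversallyCountable S → F.TransversallyCountable (sat S) := by
    intro S hS
    have hc : ∀ φ : A, Countable ((fun y ↦ φ.1 y 0) '' (S ∩ φ.1.source)) :=
      fun φ ↦ (hS φ.1 (hAF φ.2)).to_subtype
    refine (F.transversallyCountable_iUnion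
      (S := fun i : (φ : A) × ((fun y ↦ φ.1 y 0) '' (S ∩ φ.1.source)) ↦
        {y | y ∈ i.1.1.source ∧ i.1.1 y 0 = i.2.1})
      (fun i ↦ F.transversallyCountable_plaque (hAF i.1.2) _)).mono ?_
    rintro z ⟨y, hy, φ, hφ, hyφ, hzφ, hyz⟩
    exact mem_iUnion.2 ⟨⟨⟨φ, hφ⟩, ⟨φ y 0, y, ⟨hy, hyφ⟩, rfl⟩⟩, hzφ, hyz.symm⟩
  have hiter : ∀ m, F.TransversallyCountable (sat^[m] {x}) := by
    intro m
    induction m with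
    | zero => exact F.transversallyCountable_singleton x
    | succ m ih =>
      rw [Function.iterate_succ_apply']
      exact hsat _ ih
  refine (F.transversallyCountable_iUnion hiter).mono fun y hy ↦ ?_
  have hy' : Relation.ReflTransGen R x y := by
    have hy0 : Relation.ReflTransGen F.SamePlaque x y := hy
    induction hy0 with
    | refl => exact .refl
    | tail h1 h2 ih => exact (ih h1).trans (h2.reflTransGen hAF hcov)
  induction hy' with
  | refl => exact mem_iUnion.2 ⟨0, rfl⟩
  | @tail b c h1 h2 ih =>
    have hb : b ∈ F.leaf x := Relation.ReflTransGen.mono (fun y z ⟨φ, hφ, h⟩ ↦ ⟨φ, hAF hφ, h⟩) _ _ h1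
    obtain ⟨m, hm⟩ := mem_iUnion.1 (ih hb)
    refine mem_iUnion.2 ⟨m + 1, ?_⟩
    rw [Function.iterate_succ_apply']
    exact ⟨b, hm, h2⟩

/-- A continuous curve that stays in a leaf stays in a plaque for small times. -/
theorem eventually_eq_of_eventually_mem_leaf [SecondCountableTopology M]
    (F : CodimOneFoliation n M)
    {φ : OpenPartialHomeomorph M (EuclideanSpace ℝ (Fin (n + 2)))} (hφ : φ ∈ F.atlas)
    {γ : ℝ → M} (hγ : ∀ᶠ t in 𝓝 (0 : ℝ), ContinuousAt γ t) (h0 : γ 0 ∈ φ.source)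
    (hleaf : ∀ᶠ t in 𝓝 (0 : ℝ), γ t ∈ F.leaf (γ 0)) :
    ∀ᶠ t in 𝓝 (0 : ℝ), φ (γ t) 0 = φ (γ 0) 0 := by
  have hsrc : ∀ᶠ t in 𝓝 (0 : ℝ), γ t ∈ φ.source :=
    hγ.self_of_nhds.eventually_mem (φ.open_source.mem_nhds h0)
  obtain ⟨ε, hε, hball⟩ := Metric.eventually_nhds_iff_ball.1 (hγ.and (hsrc.and hleaf))
  have hcont : ContinuousOn (fun t ↦ φ (γ t) 0) (Metric.ball 0 ε) := by
    intro t ht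
    have h1 : ContinuousAt (fun t ↦ φ (γ t)) t :=
      ContinuousAt.comp (φ.continuousAt (hball t ht).2.1) (hball t ht).1
    have h2 : ContinuousAt (fun z : EuclideanSpace ℝ (Fin (n + 2)) ↦ z 0) (φ (γ t)) := by
      fun_prop
    exact (ContinuousAt.comp (f := fun t ↦ φ (γ t)) h2 h1).continuousWithinAt
  have hcount : ((fun t ↦ φ (γ t) 0) '' Metric.ball 0 ε).Countable := by
    refine (F.transversallyCountable_leaf (γ 0) φ hφ).mono ?_
    rintro _ ⟨t, ht, rfl⟩
    exact ⟨γ t, ⟨(hball t ht).2.2, (hball t ht).2.1⟩, rfl⟩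
  have hsub : ((fun t ↦ φ (γ t) 0) '' Metric.ball 0 ε).Subsingleton :=
    hcount.isTotallyDisconnected _ Subset.rfl
      ((convex_ball (0 : ℝ) ε).isPreconnected.image _ hcont)
  filter_upwards [Metric.ball_mem_nhds (0 : ℝ) hε] with t ht
  exact hsub (mem_image_of_mem _ ht) (mem_image_of_mem _ (Metric.mem_ball_self hε))

end CodimOneFoliation

/-! ### Straightening a vector field -/

section FlowBox

/-- A smooth vector field on an open set agrees near each point of it with one that is smooth
everywhere, vanishes off the open set, and is pointwise a multiple of the given one. -/
theorem exists_contDiff_cutoff {E : Type*} [NormedAddCommGroup E] [NormedSpace ℝ E]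
    [FiniteDimensional ℝ E] {T : Set E} (hT : IsOpen T) {f : E → E} (hf : ContDiffOn ℝ ∞ f T)
    {p : E} (hp : p ∈ T) :
    ∃ f' : E → E, ContDiff ℝ ∞ f' ∧ f' =ᶠ[𝓝 p] f ∧
      ∀ z, f' z ≠ 0 → z ∈ T ∧ ∃ a : ℝ, f' z = a • f z := by
  obtain ⟨ρ, hρ, hball⟩ := Metric.isOpen_iff.1 hT p hp
  let b : ContDiffBump p := ⟨ρ / 3, ρ / 2, by positivity, by linarith⟩
  have hout : ∀ z, z ∉ Metric.closedBall p (ρ / 2) → b z = 0 := by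
    intro z hz
    refine b.zero_of_le_dist ?_
    exact (not_le.1 (fun h ↦ hz (Metric.mem_closedBall.2 h))).le
  have hsub : Metric.closedBall p (ρ / 2) ⊆ T :=
    (Metric.closedBall_subset_ball (by linarith)).trans hball
  refine ⟨fun z ↦ b z • f z, ?_, ?_, fun z hz ↦ ⟨?_, b z, rfl⟩⟩
  · rw [contDiff_iff_contDiffAt]
    intro z
    by_cases hz : z ∈ T
    · exact b.contDiff.contDiffAt.smul ((hf z hz).contDiffAt (hT.mem_nhds hz))
    · have hz' : z ∈ (Metric.closedBall p (ρ / 2))ᶜ := fun h ↦ hz (hsub h)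
      refine (contDiffAt_const (c := (0 : E))).congr_of_eventuallyEq ?_
      filter_upwards [Metric.isClosed_closedBall.isOpen_compl.mem_nhds hz'] with y hy
      rw [hout y hy, zero_smul]
  · filter_upwards [b.eventuallyEq_one] with z hz
    rw [hz, Pi.one_apply, one_smul]
  · by_contra hzT
    refine hz ?_
    change b z • f z = 0
    rw [hout z fun h ↦ hzT (hsub h), zero_smul]

variable {n : ℕ}

/-- A linear automorphism of `ℝⁿ⁺²` that preserves the `0`-th coordinate and maps the `1`-st
basis vector to a prescribed nonzero vector with vanishing `0`-th coordinate. -/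
theorem exists_linear_frame {a : EuclideanSpace ℝ (Fin (n + 2))} (ha : a ≠ 0) (ha0 : a 0 = 0) :
    ∃ A : EuclideanSpace ℝ (Fin (n + 2)) ≃L[ℝ] EuclideanSpace ℝ (Fin (n + 2)),
      A (EuclideanSpace.single 1 1) = a ∧ ∀ z, A z 0 = z 0 := by
  obtain ⟨j, hj⟩ : ∃ j, a j ≠ 0 := by
    by_contra! h
    exact ha (by ext i; simpa using h i)
  have hj0 : j ≠ 0 := fun h ↦ hj (h ▸ ha0)
  let P : EuclideanSpace ℝ (Fin (n + 2)) →ₗ[ℝ] EuclideanSpace ℝ (Fin (n + 2)) :=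
    (LinearIsometryEquiv.piLpCongrLeft 2 ℝ ℝ (Equiv.swap 1 j)).toLinearEquiv.toLinearMap
  have hP : ∀ z i, P z i = z (Equiv.swap 1 j i) := by
    intro z i
    simp [P, LinearIsometryEquiv.piLpCongrLeft_apply, Equiv.piCongrLeft'_apply]
  let B : EuclideanSpace ℝ (Fin (n + 2)) →ₗ[ℝ] EuclideanSpace ℝ (Fin (n + 2)) :=
    P + (EuclideanSpace.proj (𝕜 := ℝ) (1 : Fin (n + 2))).toLinearMap.smulRight
      (a - EuclideanSpace.single j 1)
  have hB : ∀ z i, B z i = z (Equiv.swap 1 j i) + z 1 * (a i - if i = j then 1 else 0) := by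
    intro z i
    simp [B, hP]
  have hswap0 : Equiv.swap 1 j (0 : Fin (n + 2)) = 0 :=
    Equiv.swap_apply_of_ne_of_ne (by simp) hj0.symm
  have hinj : Function.Injective B := by
    rw [← LinearMap.ker_eq_bot, LinearMap.ker_eq_bot']
    intro z hz
    have hz' : ∀ i, B z i = 0 := fun i ↦ by rw [hz]; rfl
    have h1 : z 1 = 0 := by
      have := hz' j
      rw [hB, Equiv.swap_apply_right, if_pos rfl] at this
      have h2 : z 1 * a j = 0 := by linarith
      exact (mul_eq_zero.1 h2).resolve_right hj
    ext i
    have := hz' (Equiv.swap 1 j i)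
    rw [hB, Equiv.swap_apply_self, h1] at this
    simpa using this
  refine ⟨(LinearEquiv.ofInjectiveEndo B hinj).toContinuousLinearEquiv, ?_, fun z ↦ ?_⟩
  · change B (EuclideanSpace.single 1 1) = a
    ext i
    rw [hB]
    by_cases hi : i = j
    · subst hi; simp
    · have : Equiv.swap 1 j i ≠ 1 := by
        intro h
        apply hi
        rw [← Equiv.swap_apply_self 1 j i, h, Equiv.swap_apply_left]
      simp [hi, this]
  · change B z 0 = z 0
    rw [hB, hswap0, ha0, if_neg hj0.symm]
    ring

/-- **Straightening theorem** for a vector field `f` tangent to the level sets of the `0`-th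
coordinate: near a point where `f ≠ 0` there are coordinates in which `f` is the `1`-st
coordinate field and the `0`-th coordinate is, up to a constant, the old one. -/
theorem exists_flowBox {T : Set (EuclideanSpace ℝ (Fin (n + 2)))} (hT : IsOpen T)
    {f : EuclideanSpace ℝ (Fin (n + 2)) → EuclideanSpace ℝ (Fin (n + 2))}
    (hf : ContDiffOn ℝ ∞ f T) (hf0 : ∀ z ∈ T, f z 0 = 0)
    {p : EuclideanSpace ℝ (Fin (n + 2))} (hp : p ∈ T) (hfp : f p ≠ 0) :
    ∃ (Ψ : OpenPartialHomeomorph (EuclideanSpace ℝ (Fin (n + 2)))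
        (EuclideanSpace ℝ (Fin (n + 2)))) (r : ℝ), 0 < r ∧ Ψ.source = Metric.ball 0 r ∧
      Ψ 0 = p ∧ Ψ.target ⊆ T ∧ ContDiffOn ℝ ∞ Ψ Ψ.source ∧ ContDiffOn ℝ ∞ Ψ.symm Ψ.target ∧
      ∀ z ∈ Ψ.source, Ψ z 0 = z 0 + p 0 ∧
        fderiv ℝ Ψ z (EuclideanSpace.single 1 1) = f (Ψ z) := by
  obtain ⟨f', hf', hff', hf'T⟩ := exists_contDiff_cutoff hT hf hp
  have hf'0 : ∀ z, f' z 0 = 0 := by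
    intro z
    by_cases hz : f' z = 0
    · rw [hz]; rfl
    · obtain ⟨hzT, a, ha⟩ := hf'T z hz
      simp [ha, hf0 z hzT]
  obtain ⟨ε, hε, Θ, hΘ, hflow⟩ := exists_contDiffOn_flow f' hf' p
  obtain ⟨A, hA1, hA0⟩ := exists_linear_frame hfp (hf0 p hp)
  set e1 : EuclideanSpace ℝ (Fin (n + 2)) := EuclideanSpace.single 1 1 with he1
  let π : EuclideanSpace ℝ (Fin (n + 2)) →L[ℝ] ℝ := EuclideanSpace.proj 1
  -- `ψ z` below flows for time `z 1` from the point `p + L z` of the slice `z 1 = 0`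
  let L : EuclideanSpace ℝ (Fin (n + 2)) →L[ℝ] EuclideanSpace ℝ (Fin (n + 2)) :=
    (A : EuclideanSpace ℝ (Fin (n + 2)) →L[ℝ] EuclideanSpace ℝ (Fin (n + 2))).comp
      (ContinuousLinearMap.id ℝ _ - π.smulRight e1)
  have hL : ∀ z, L z = A (z - z 1 • e1) := fun z ↦ rfl
  have hL0 : ∀ z, L z 0 = z 0 := by
    intro z
    rw [hL, hA0]
    simp [he1]
  have hL1 : L e1 = 0 := by
    rw [hL]
    simp [he1]
  let q : EuclideanSpace ℝ (Fin (n + 2)) → ℝ × EuclideanSpace ℝ (Fin (n + 2)) :=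
    fun z ↦ (z 1, p + L z)
  have hq : ContDiff ℝ ∞ q := π.contDiff.prodMk (contDiff_const.add L.contDiff)
  have hq0 : q 0 = (0, p) := by simp [q]
  set Box : Set (ℝ × EuclideanSpace ℝ (Fin (n + 2))) := Ioo (-ε) ε ×ˢ Metric.ball p ε with hBox
  have hBoxo : IsOpen Box := isOpen_Ioo.prod Metric.isOpen_ball
  have h0Box : q 0 ∈ Box := by
    rw [hq0]
    exact ⟨⟨by linarith, hε⟩, Metric.mem_ball_self hε⟩
  have hDo : IsOpen (q ⁻¹' Box) := hBoxo.preimage hq.continuous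
  let ψ : EuclideanSpace ℝ (Fin (n + 2)) → EuclideanSpace ℝ (Fin (n + 2)) := fun z ↦ Θ (q z)
  have hψ : ∀ z ∈ q ⁻¹' Box, ContDiffAt ℝ ∞ ψ z := fun z hz ↦
    ((hΘ (q z) hz).contDiffAt (hBoxo.mem_nhds hz)).comp z hq.contDiffAt
  have hψ00 : ψ 0 = p := by
    change Θ (q 0) = p
    rw [hq0]
    exact (hflow p (Metric.mem_ball_self hε)).1
  -- the flow preserves the `0`-th coordinate
  have hψ0 : ∀ z ∈ q ⁻¹' Box, ψ z 0 = z 0 + p 0 := by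
    intro z hz
    obtain ⟨h1, h2⟩ := hflow _ hz.2
    have hder : ∀ t ∈ Ioo (-ε) ε, HasDerivAt (fun t ↦ Θ (t, p + L z) 0) 0 t := by
      intro t ht
      have := (EuclideanSpace.proj (𝕜 := ℝ) (0 : Fin (n + 2))).hasFDerivAt.comp_hasDerivAt t
        (h2 t ht)
      rw [show (EuclideanSpace.proj (𝕜 := ℝ) (0 : Fin (n + 2))) (f' (Θ (t, (q z).2))) = 0 from
        hf'0 _] at this
      exact this
    have hconst := isOpen_Ioo.is_const_of_deriv_eq_zero (isPreconnected_Ioo)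
      (fun t ht ↦ (hder t ht).differentiableAt.differentiableWithinAt)
      (fun t ht ↦ (hder t ht).deriv) hz.1 (show (0 : ℝ) ∈ Ioo (-ε) ε from ⟨by linarith, hε⟩)
    change Θ (z 1, p + L z) 0 = _
    have hconst' : Θ (z 1, p + L z) 0 = Θ (0, p + L z) 0 := hconst
    rw [hconst']
    have h3 : Θ (0, p + L z) = p + L z := h1
    rw [h3, PiLp.add_apply, hL0]
    ring
  have hψ1 : ∀ z ∈ q ⁻¹' Box, fderiv ℝ ψ z e1 = f' (ψ z) := by
    intro z hz
    have hline : HasDerivAt (fun s : ℝ ↦ z + s • e1) e1 0 := by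
      simpa using ((hasDerivAt_id (0 : ℝ)).smul_const e1).const_add z
    have hd : HasFDerivAt ψ (fderiv ℝ ψ z) (z + (0 : ℝ) • e1) := by
      rw [zero_smul, add_zero]
      exact ((hψ z hz).differentiableAt (by simp)).hasFDerivAt
    have h1 := hd.comp_hasDerivAt (0 : ℝ) hline
    have h2 := (hflow _ hz.2).2 (z 1) hz.1
    have h3 : HasDerivAt (fun s : ℝ ↦ z 1 + s) 1 0 := (hasDerivAt_id 0).const_add _
    have h2' : HasDerivAt (fun t ↦ Θ (t, p + L z)) (f' (ψ z)) (z 1 + 0) := by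
      rw [add_zero]
      exact h2
    have h4 := h2'.scomp (0 : ℝ) h3
    rw [one_smul] at h4
    refine h1.unique (h4.congr_of_eventuallyEq (Eventually.of_forall fun s ↦ ?_))
    simp only [Function.comp_apply, ψ, q, map_add, map_smul, hL1]
    simp [he1]
  -- at the origin the derivative is `A`: flowing for no time is the identity, and `∂_v ψ = A e1`
  have hψd : HasFDerivAt ψ
      (A : EuclideanSpace ℝ (Fin (n + 2)) →L[ℝ] EuclideanSpace ℝ (Fin (n + 2))) 0 := by
    have hd := ((hψ 0 h0Box).differentiableAt (by simp)).hasFDerivAt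
    have hΘd : HasFDerivAt Θ (fderiv ℝ Θ (0, p)) (0, p) :=
      (((hΘ (0, p) (hq0 ▸ h0Box)).contDiffAt (hBoxo.mem_nhds (hq0 ▸ h0Box))).differentiableAt
        (by simp)).hasFDerivAt
    have hx : ∀ v, fderiv ℝ Θ (0, p) (0, v) = v := by
      intro v
      have h1 := hΘd.comp p ((hasFDerivAt_const (0 : ℝ) p).prodMk (hasFDerivAt_id p))
      have h2 : (Θ ∘ fun x ↦ ((0 : ℝ), id x)) =ᶠ[𝓝 p] id := by
        filter_upwards [Metric.ball_mem_nhds p hε] with x hx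
        exact (hflow x hx).1
      have h3 := (h1.congr_of_eventuallyEq h2.symm).unique (hasFDerivAt_id p)
      simpa using congrArg (fun B ↦ B v) h3
    have hfd : ∀ v, fderiv ℝ ψ 0 v = A v := by
      intro v
      have hdecomp : v = (v - v 1 • e1) + v 1 • e1 := by abel
      have h1 : fderiv ℝ ψ 0 e1 = A e1 := by
        rw [hψ1 0 h0Box, hψ00, hff'.eq_of_nhds, hA1]
      have h2 : ∀ v : EuclideanSpace ℝ (Fin (n + 2)), v 1 = 0 → fderiv ℝ ψ 0 v = A v := by
        intro v hv
        have hqd : HasFDerivAt q (π.prod L) 0 :=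
          π.hasFDerivAt.prodMk (L.hasFDerivAt.const_add p)
        have hΘd' : HasFDerivAt Θ (fderiv ℝ Θ (0, p)) (q 0) := hq0 ▸ hΘd
        have hcomp : HasFDerivAt ψ ((fderiv ℝ Θ (0, p)).comp (π.prod L)) 0 := hΘd'.comp 0 hqd
        rw [hcomp.fderiv]
        have hπ : π v = 0 := hv
        simp only [ContinuousLinearMap.comp_apply, ContinuousLinearMap.prod_apply, hπ, hx, hL, hv,
          zero_smul, sub_zero]
      rw [hdecomp, map_add, map_add, map_smul, map_smul, h1, h2 _ (by simp [he1])]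
    have : fderiv ℝ ψ 0 = (A : EuclideanSpace ℝ (Fin (n + 2)) →L[ℝ] _) :=
      ContinuousLinearMap.ext hfd
    rwa [this] at hd
  let e := (hψ 0 h0Box).toOpenPartialHomeomorph ψ hψd (by simp)
  have he : ⇑e = ψ := ContDiffAt.toOpenPartialHomeomorph_coe _ _ _
  have hes : 0 ∈ e.source := ContDiffAt.mem_toOpenPartialHomeomorph_source _ _ _
  have hinv : ∀ᶠ z in 𝓝 0, fderiv ℝ ψ z ∈
      range ((↑) : (EuclideanSpace ℝ (Fin (n + 2)) ≃L[ℝ] EuclideanSpace ℝ (Fin (n + 2))) →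
        (EuclideanSpace ℝ (Fin (n + 2)) →L[ℝ] EuclideanSpace ℝ (Fin (n + 2)))) := by
    refine ((hψ 0 h0Box).fderiv_right (m := 0) (by simp)).continuousAt.eventually_mem ?_
    rw [hψd.fderiv]
    exact ContinuousLinearEquiv.nhds _
  have hgood : ∀ᶠ z in 𝓝 0, ψ z ∈ T ∧ f' (ψ z) = f (ψ z) := by
    have h1 : Tendsto ψ (𝓝 0) (𝓝 p) := by
      have := (hψ 0 h0Box).continuousAt
      rwa [ContinuousAt, hψ00] at this
    exact h1.eventually ((hT.eventually_mem hp).and hff')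
  obtain ⟨r, hr, hball⟩ := Metric.eventually_nhds_iff_ball.1
    ((e.open_source.eventually_mem hes).and
      ((hDo.eventually_mem h0Box).and (hinv.and hgood)))
  have hsrc : (e.restrOpen (Metric.ball 0 r) Metric.isOpen_ball).source = Metric.ball 0 r := by
    rw [OpenPartialHomeomorph.restrOpen_source]
    exact inter_eq_right.2 fun z hz ↦ (hball z hz).1
  have hcoe : ⇑(e.restrOpen (Metric.ball 0 r) Metric.isOpen_ball) = ψ := he
  refine ⟨e.restrOpen (Metric.ball 0 r) Metric.isOpen_ball, r, hr, hsrc, ?_, ?_, ?_, ?_, ?_⟩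
  · rw [hcoe, hψ00]
  · intro y hy
    have h1 := OpenPartialHomeomorph.map_target _ hy
    rw [hsrc] at h1
    rw [← OpenPartialHomeomorph.right_inv _ hy, hcoe]
    exact (hball _ h1).2.2.2.1
  · rw [hsrc, hcoe]
    exact fun z hz ↦ (hψ z (hball z hz).2.1).contDiffWithinAt
  · intro y hy
    have h1 := OpenPartialHomeomorph.map_target _ hy
    rw [hsrc] at h1
    obtain ⟨B, hB⟩ := (hball _ h1).2.2.1
    refine (OpenPartialHomeomorph.contDiffAt_symm _ (f₀' := B) hy ?_ ?_).contDiffWithinAt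
    · rw [hcoe, hB]
      exact ((hψ _ (hball _ h1).2.1).differentiableAt (by simp)).hasFDerivAt
    · rw [hcoe]
      exact hψ _ (hball _ h1).2.1
  · rw [hsrc, hcoe]
    intro z hz
    exact ⟨hψ0 z (hball z hz).2.1, (hψ1 z (hball z hz).2.1).trans (hball z hz).2.2.2.2⟩

end FlowBox

/-! ### Geodesics of a metric in coordinates -/

section CoordinateMetric

variable {E : Type*} [NormedAddCommGroup E] [NormedSpace ℝ E] [FiniteDimensional ℝ E]

/-- A nondegenerate bilinear form on a finite-dimensional space is a linear isomorphism onto the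
dual. -/
theorem exists_equiv_of_nondegenerate {B : E →L[ℝ] E →L[ℝ] ℝ}
    (hB : ∀ v, (∀ w, B v w = 0) → v = 0) :
    ∃ L : E ≃L[ℝ] (E →L[ℝ] ℝ), (L : E →L[ℝ] E →L[ℝ] ℝ) = B := by
  have hinj : Function.Injective (B : E →ₗ[ℝ] E →L[ℝ] ℝ) := by
    rw [← LinearMap.ker_eq_bot, LinearMap.ker_eq_bot']
    exact fun v hv ↦ hB v fun w ↦ by
      have : B v = 0 := hv
      rw [this]; rfl
  have hdim : Module.finrank ℝ E = Module.finrank ℝ (E →L[ℝ] ℝ) := by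
    rw [← (LinearMap.toContinuousLinearMap : (E →ₗ[ℝ] ℝ) ≃ₗ[ℝ] (E →L[ℝ] ℝ)).finrank_eq]
    exact (Subspace.dual_finrank_eq (K := ℝ) (V := E)).symm
  exact ⟨((B : E →ₗ[ℝ] E →L[ℝ] ℝ).linearEquivOfInjective hinj hdim).toContinuousLinearEquiv, rfl⟩

theorem apply_inverse_of_nondegenerate {B : E →L[ℝ] E →L[ℝ] ℝ}
    (hB : ∀ v, (∀ w, B v w = 0) → v = 0) (α : E →L[ℝ] ℝ) : B (B.inverse α) = α := by
  obtain ⟨L, rfl⟩ := exists_equiv_of_nondegenerate hB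
  rw [ContinuousLinearMap.inverse_equiv]
  exact L.apply_symm_apply α

variable {T : Set E} {G : E → E →L[ℝ] E →L[ℝ] ℝ}

/-- Raising indices with a smooth metric is smooth. -/
theorem contDiffOn_inverse (hG : ContDiffOn ℝ ∞ G T)
    (hnd : ∀ z ∈ T, ∀ v, (∀ w, G z v w = 0) → v = 0) :
    ContDiffOn ℝ ∞ (fun z ↦ (G z).inverse) T := by
  intro z hz
  obtain ⟨L, hL⟩ := exists_equiv_of_nondegenerate (hnd z hz)
  have h := contDiffAt_map_inverse (n := ∞) L
  rw [hL] at h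
  exact h.comp_contDiffWithinAt z (hG z hz)

omit [FiniteDimensional ℝ E] in
theorem fderiv_apply_apply {z : E} (h : DifferentiableAt ℝ G z) (u v w : E) :
    fderiv ℝ (fun z ↦ G z v w) z u = fderiv ℝ G z u v w := by
  have h1 := ((h.hasFDerivAt.clm_apply (hasFDerivAt_const v z)).clm_apply (hasFDerivAt_const w z))
  rw [h1.fderiv]
  simp

set_option maxSynthPendingDepth 3 in
/-- Local existence of geodesics of a metric `G` on an open set of a vector space, for any initial
position and velocity. -/
theorem exists_geodesic (hT : IsOpen T) (hG : ContDiffOn ℝ ∞ G T)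
    (hnd : ∀ z ∈ T, ∀ v, (∀ w, G z v w = 0) → v = 0) {z : E} (hz : z ∈ T) (v : E) :
    ∃ (ε : ℝ) (c : ℝ → E), 0 < ε ∧ c 0 = z ∧ deriv c 0 = v ∧ ContDiffOn ℝ 2 c (Ioo (-ε) ε) ∧
      ∀ t ∈ Ioo (-ε) ε, c t ∈ T ∧ ∀ w, G (c t) (deriv (deriv c) t) w
        + fderiv ℝ G (c t) (deriv c t) (deriv c t) w
        - 1 / 2 * fderiv ℝ G (c t) w (deriv c t) (deriv c t) = 0 := by
  have hDG : ContDiffOn ℝ ∞ (fderiv ℝ G) T := hG.fderiv_of_isOpen hT (by simp)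
  have hDGx : ContDiffOn ℝ ∞ (fun x : E × E ↦ fderiv ℝ G x.1) (T ×ˢ univ) :=
    hDG.comp contDiffOn_fst fun x hx ↦ hx.1
  -- the force term of the geodesic equation
  let ρ : E × E → E →L[ℝ] ℝ := fun x ↦
    (1 / 2 : ℝ) • ((fderiv ℝ G x.1).flip x.2).flip x.2 - fderiv ℝ G x.1 x.2 x.2
  have hρ : ContDiffOn ℝ ∞ ρ (T ×ˢ univ) := by
    rw [contDiffOn_clm_apply]
    intro w
    have h1 : ContDiffOn ℝ ∞ (fun x : E × E ↦ fderiv ℝ G x.1 w x.2 x.2) (T ×ˢ univ) :=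
      ((hDGx.clm_apply contDiffOn_const).clm_apply contDiffOn_snd).clm_apply contDiffOn_snd
    have h2 : ContDiffOn ℝ ∞ (fun x : E × E ↦ fderiv ℝ G x.1 x.2 x.2 w) (T ×ˢ univ) :=
      ((hDGx.clm_apply contDiffOn_snd).clm_apply contDiffOn_snd).clm_apply contDiffOn_const
    exact (h1.const_smul (1 / 2 : ℝ)).sub h2
  let X : E × E → E × E := fun x ↦ (x.2, (G x.1).inverse (ρ x))
  have hX : ContDiffOn ℝ ∞ X (T ×ˢ univ) :=
    contDiffOn_snd.prodMk (((contDiffOn_inverse hG hnd).comp contDiffOn_fst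
      fun x hx ↦ hx.1).clm_apply hρ)
  have hTo : IsOpen (T ×ˢ (univ : Set E)) := hT.prod isOpen_univ
  have hXat : ContDiffAt ℝ 1 X (z, v) :=
    ((hX (z, v) ⟨hz, mem_univ _⟩).contDiffAt (hTo.mem_nhds ⟨hz, mem_univ _⟩)).of_le (by simp)
  obtain ⟨α, hα0, ε₀, hε₀, hα⟩ :=
    hXat.exists_forall_mem_closedBall_exists_eq_forall_mem_Ioo_hasDerivAt₀ 0
  rw [zero_sub, zero_add] at hα
  have hαT : ∀ᶠ t in 𝓝 (0 : ℝ), (α t).1 ∈ T := by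
    have h1 : ContinuousAt (fun t ↦ (α t).1) 0 :=
      (hα 0 ⟨by linarith, hε₀⟩).continuousAt.fst
    refine h1.eventually_mem (hT.mem_nhds ?_)
    rw [hα0]
    exact hz
  obtain ⟨ε₁, hε₁, hball⟩ := Metric.eventually_nhds_iff_ball.1 hαT
  rw [Real.ball_eq_Ioo, zero_sub, zero_add] at hball
  set ε := min ε₀ ε₁ with hε
  have hεpos : 0 < ε := lt_min hε₀ hε₁
  have hαε : ∀ t ∈ Ioo (-ε) ε, HasDerivAt α (X (α t)) t := fun t ht ↦
    hα t ⟨by linarith [ht.1, min_le_left ε₀ ε₁], ht.2.trans_le (min_le_left _ _)⟩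
  have hTε : ∀ t ∈ Ioo (-ε) ε, (α t).1 ∈ T := fun t ht ↦
    hball t ⟨by linarith [ht.1, min_le_right ε₀ ε₁], ht.2.trans_le (min_le_right _ _)⟩
  have h0 : (0 : ℝ) ∈ Ioo (-ε) ε := ⟨by linarith, hεpos⟩
  have hd1 : ∀ t ∈ Ioo (-ε) ε, HasDerivAt (fun t ↦ (α t).1) (α t).2 t := fun t ht ↦
    (hαε t ht).fst
  have hd1' : ∀ t ∈ Ioo (-ε) ε, deriv (fun t ↦ (α t).1) t = (α t).2 := fun t ht ↦ (hd1 t ht).deriv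
  have hd2 : ∀ t ∈ Ioo (-ε) ε, HasDerivAt (deriv fun t ↦ (α t).1) (X (α t)).2 t := by
    intro t ht
    have h : HasDerivAt (fun t ↦ (α t).2) (X (α t)).2 t := (hαε t ht).snd
    refine h.congr_of_eventuallyEq ?_
    filter_upwards [isOpen_Ioo.mem_nhds ht] with s hs
    exact hd1' s hs
  refine ⟨ε, fun t ↦ (α t).1, hεpos, congrArg Prod.fst hα0, by rw [hd1' 0 h0, hα0], ?_, fun t ht ↦
    ⟨hTε t ht, fun w ↦ ?_⟩⟩
  · have h2 : (2 : WithTop ℕ∞) = 1 + 1 := by norm_num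
    rw [h2, contDiffOn_succ_iff_deriv_of_isOpen isOpen_Ioo]
    refine ⟨fun t ht ↦ (hd1 t ht).differentiableAt.differentiableWithinAt, by simp, ?_⟩
    rw [show (1 : WithTop ℕ∞) = 0 + 1 from (zero_add 1).symm,
      contDiffOn_succ_iff_deriv_of_isOpen isOpen_Ioo, contDiffOn_zero]
    refine ⟨fun t ht ↦ (hd2 t ht).differentiableAt.differentiableWithinAt, by simp, ?_⟩
    have hcont : ContinuousOn (fun t ↦ (X (α t)).2) (Ioo (-ε) ε) := by
      refine (hX.continuousOn.comp (fun t ht ↦ (hαε t ht).continuousAt.continuousWithinAt)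
        fun t ht ↦ ⟨hTε t ht, mem_univ _⟩).snd
    exact hcont.congr fun t ht ↦ (hd2 t ht).deriv
  · rw [(hd2 t ht).deriv, hd1' t ht]
    have h1 : G (α t).1 (X (α t)).2 = ρ (α t) :=
      apply_inverse_of_nondegenerate (hnd _ (hTε t ht)) _
    rw [h1]
    simp [ρ]

omit [FiniteDimensional ℝ E] in
/-- If the geodesic with initial velocity `v` in the kernel of a linear function `ℓ` stays in a
level set of `ℓ`, then the gradient field `N` of `ℓ` satisfies the Killing equation in the
direction `v`: `(L_N G)(v, v) = 0`. -/
theorem killing_of_geodesic (hT : IsOpen T) (hG : ContDiffOn ℝ ∞ G T)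
    (hsymm : ∀ z ∈ T, ∀ v w, G z v w = G z w v) {ℓ : E →L[ℝ] ℝ} {N : E → E}
    (hN : ContDiffOn ℝ ∞ N T) (hGN : ∀ z ∈ T, ∀ w, G z (N z) w = ℓ w)
    {c : ℝ → E} (hc0 : c 0 ∈ T)
    (hc : ∀ᶠ t in 𝓝 (0 : ℝ), DifferentiableAt ℝ c t) (hc' : DifferentiableAt ℝ (deriv c) 0)
    (hgeod : ∀ w, G (c 0) (deriv (deriv c) 0) w
        + fderiv ℝ G (c 0) (deriv c 0) (deriv c 0) w
        - 1 / 2 * fderiv ℝ G (c 0) w (deriv c 0) (deriv c 0) = 0)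
    (hconst : ∀ᶠ t in 𝓝 (0 : ℝ), ℓ (c t) = ℓ (c 0)) :
    G (c 0) (deriv c 0) (fderiv ℝ N (c 0) (deriv c 0))
      + 1 / 2 * fderiv ℝ G (c 0) (N (c 0)) (deriv c 0) (deriv c 0) = 0 := by
  have hGd : HasFDerivAt G (fderiv ℝ G (c 0)) (c 0) :=
    (((hG _ hc0).contDiffAt (hT.mem_nhds hc0)).differentiableAt (by simp)).hasFDerivAt
  have hNd : HasFDerivAt N (fderiv ℝ N (c 0)) (c 0) :=
    (((hN _ hc0).contDiffAt (hT.mem_nhds hc0)).differentiableAt (by simp)).hasFDerivAt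
  -- the acceleration is tangent to the level set
  have hacc : ℓ (deriv (deriv c) 0) = 0 := by
    have h1 : (fun t ↦ ℓ (deriv c t)) =ᶠ[𝓝 0] fun _ ↦ 0 := by
      filter_upwards [hc, hconst.eventually_nhds] with t ht ht'
      have h2 := ℓ.hasFDerivAt.comp_hasDerivAt t ht.hasDerivAt
      have h3 : (ℓ ∘ c) =ᶠ[𝓝 t] fun _ ↦ ℓ (c 0) := ht'
      exact h2.unique ((hasDerivAt_const t (ℓ (c 0))).congr_of_eventuallyEq h3)
    have h2 := ℓ.hasFDerivAt.comp_hasDerivAt 0 hc'.hasDerivAt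
    exact h2.unique ((hasDerivAt_const (0 : ℝ) (0 : ℝ)).congr_of_eventuallyEq h1)
  -- the derivative of the relation `G (v, N) = ℓ v`
  have hprod : fderiv ℝ G (c 0) (deriv c 0) (deriv c 0) (N (c 0))
      + G (c 0) (deriv c 0) (fderiv ℝ N (c 0) (deriv c 0)) = 0 := by
    have h1 := (hGd.clm_apply (hasFDerivAt_const (deriv c 0) (c 0))).clm_apply hNd
    have h2 : (fun z ↦ G z (deriv c 0) (N z)) =ᶠ[𝓝 (c 0)] fun _ ↦ ℓ (deriv c 0) := by
      filter_upwards [hT.mem_nhds hc0] with z hz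
      rw [hsymm z hz, hGN z hz]
    have h3 := h1.unique ((hasFDerivAt_const (ℓ (deriv c 0)) (c 0)).congr_of_eventuallyEq h2)
    have h4 := congrArg (fun B ↦ B (deriv c 0)) h3
    simp at h4
    linarith
  have h1 := hgeod (N (c 0))
  rw [hsymm _ hc0, hGN _ hc0, hacc] at h1
  linarith

omit [FiniteDimensional ℝ E] in
/-- Polarization of the Killing equation `(L_N G)(v, v) = 0` for `v` in the kernel of `ℓ`. -/
theorem killing_polarization (hT : IsOpen T) (hG : ContDiffOn ℝ ∞ G T)
    (hsymm : ∀ z ∈ T, ∀ v w, G z v w = G z w v) {ℓ : E →L[ℝ] ℝ} {N : E → E} {z : E} (hz : z ∈ T)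
    (hK : ∀ v, ℓ v = 0 → G z v (fderiv ℝ N z v) + 1 / 2 * fderiv ℝ G z (N z) v v = 0)
    {a b : E} (ha : ℓ a = 0) (hb : ℓ b = 0) :
    fderiv ℝ G z (N z) a b + G z (fderiv ℝ N z a) b + G z a (fderiv ℝ N z b) = 0 := by
  have hGd : DifferentiableAt ℝ G z :=
    ((hG _ hz).contDiffAt (hT.mem_nhds hz)).differentiableAt (by simp)
  have hs : fderiv ℝ G z (N z) b a = fderiv ℝ G z (N z) a b := by
    rw [← fderiv_apply_apply hGd, ← fderiv_apply_apply hGd]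
    have : (fun z ↦ G z b a) =ᶠ[𝓝 z] fun z ↦ G z a b := by
      filter_upwards [hT.mem_nhds hz] with y hy
      exact hsymm y hy b a
    rw [this.fderiv_eq]
  have h1 := hK (a + b) (by rw [map_add, ha, hb, add_zero])
  have h2 := hK a ha
  have h3 := hK b hb
  simp only [map_add, add_apply, hs] at h1
  rw [hsymm z hz (fderiv ℝ N z a) b]
  linarith

set_option maxSynthPendingDepth 3 in
omit [FiniteDimensional ℝ E] in
/-- The Lie derivative of the metric along `N`, computed in a parametrization `Ψ` in which `N` is
the coordinate field `e`, is the derivative along `e` of the metric coefficients, since the second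
derivatives of `Ψ` are symmetric. Here both vanish on the coordinate vectors `a`, `b`. -/
theorem fderiv_pullback_eq_zero (hT : IsOpen T) (hG : ContDiffOn ℝ ∞ G T)
    {N : E → E} (hN : ContDiffOn ℝ ∞ N T) {S : Set E} (hS : IsOpen S) {Ψ : E → E}
    (hΨ : ContDiffOn ℝ ∞ Ψ S) (hST : MapsTo Ψ S T) {e : E}
    (he : ∀ z ∈ S, fderiv ℝ Ψ z e = N (Ψ z)) {z : E} (hz : z ∈ S) {a b : E}
    (hK : fderiv ℝ G (Ψ z) (N (Ψ z)) (fderiv ℝ Ψ z a) (fderiv ℝ Ψ z b)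
      + G (Ψ z) (fderiv ℝ N (Ψ z) (fderiv ℝ Ψ z a)) (fderiv ℝ Ψ z b)
      + G (Ψ z) (fderiv ℝ Ψ z a) (fderiv ℝ N (Ψ z) (fderiv ℝ Ψ z b)) = 0) :
    fderiv ℝ (fun z ↦ G (Ψ z) (fderiv ℝ Ψ z a) (fderiv ℝ Ψ z b)) z e = 0 := by
  have hΨz : ContDiffAt ℝ ∞ Ψ z := (hΨ z hz).contDiffAt (hS.mem_nhds hz)
  have hΨd := (hΨz.differentiableAt (by simp)).hasFDerivAt
  have hGd : HasFDerivAt G (fderiv ℝ G (Ψ z)) (Ψ z) :=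
    (((hG _ (hST hz)).contDiffAt (hT.mem_nhds (hST hz))).differentiableAt (by simp)).hasFDerivAt
  have hNd : HasFDerivAt N (fderiv ℝ N (Ψ z)) (Ψ z) :=
    (((hN _ (hST hz)).contDiffAt (hT.mem_nhds (hST hz))).differentiableAt (by simp)).hasFDerivAt
  have hBd : HasFDerivAt (fderiv ℝ Ψ) (fderiv ℝ (fderiv ℝ Ψ) z) z :=
    ((hΨz.fderiv_right (m := 1) (by norm_cast)).differentiableAt (by simp)).hasFDerivAt
  have hsnd : ∀ a, fderiv ℝ (fderiv ℝ Ψ) z e a = fderiv ℝ N (Ψ z) (fderiv ℝ Ψ z a) := by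
    intro a
    have h0 : IsSymmSndFDerivAt ℝ Ψ z := hΨz.isSymmSndFDerivAt (by
      rw [minSmoothness_of_isRCLikeNormedField]
      exact WithTop.coe_le_coe.2 le_top)
    rw [h0 e a]
    have h1 := hBd.clm_apply (hasFDerivAt_const e z)
    have h2 : (fun z ↦ fderiv ℝ Ψ z e) =ᶠ[𝓝 z] N ∘ Ψ := by
      filter_upwards [hS.mem_nhds hz] with y hy
      exact he y hy
    have h3 := h1.unique ((hNd.comp z hΨd).congr_of_eventuallyEq h2)
    have h4 := congrArg (fun B ↦ B a) h3
    simpa using h4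
  have hGΨ : HasFDerivAt (fun z ↦ G (Ψ z)) ((fderiv ℝ G (Ψ z)).comp (fderiv ℝ Ψ z)) z :=
    hGd.comp z hΨd
  have hmain := (hGΨ.clm_apply (hBd.clm_apply (hasFDerivAt_const a z))).clm_apply
    (hBd.clm_apply (hasFDerivAt_const b z))
  rw [hmain.fderiv]
  simp [hsnd, he z hz]
  linarith

end CoordinateMetric

/-! ### The metric and the foliation in a foliation chart -/

section ChartMetric

variable {n : ℕ} {M : Type*} [TopologicalSpace M]
  [ChartedSpace (EuclideanSpace ℝ (Fin (n + 2))) M] [IsManifold (𝓡 (n + 2)) ∞ M]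

omit [IsManifold (𝓡 (n + 2)) ∞ M] in
theorem OpenPartialHomeomorph.mDifferentiable_of_mem_maximalAtlas
    {φ : OpenPartialHomeomorph M (EuclideanSpace ℝ (Fin (n + 2)))}
    (hφ : φ ∈ IsManifold.maximalAtlas (𝓡 (n + 2)) ∞ M) :
    φ.MDifferentiable (𝓡 (n + 2)) (𝓡 (n + 2)) :=
  ⟨(contMDiffOn_of_mem_maximalAtlas hφ).mdifferentiableOn (by simp),
    (contMDiffOn_symm_of_mem_maximalAtlas hφ).mdifferentiableOn (by simp)⟩

namespace LorentzMetric

theorem eq_zero_of_forall_val_eq_zero (g : LorentzMetric n M) {x : M}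
    {v : TangentSpace (𝓡 (n + 2)) x} (h : ∀ w, g.val x v w = 0) : v = 0 := by
  obtain ⟨b, hb⟩ := g.exists_orthonormal x
  refine b.ext_elem fun j ↦ ?_
  have h1 : g.val x v (b j) = b.repr v j * if j = 0 then -1 else 1 := by
    conv_lhs => rw [← b.sum_repr v]
    rw [map_sum, sum_apply]
    simp only [map_smul, smul_apply, hb, smul_eq_mul]
    simp
  rw [h] at h1
  rw [map_zero, Finsupp.zero_apply]
  split_ifs at h1 <;> linarith

/-- The metric in the coordinates `φ`, as a function with values in bilinear forms. -/
noncomputable def metricInChart (g : LorentzMetric n M)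
    (φ : OpenPartialHomeomorph M (EuclideanSpace ℝ (Fin (n + 2))))
    (z : EuclideanSpace ℝ (Fin (n + 2))) :
    EuclideanSpace ℝ (Fin (n + 2)) →L[ℝ] EuclideanSpace ℝ (Fin (n + 2)) →L[ℝ] ℝ :=
  ContinuousLinearMap.bilinearComp (E := EuclideanSpace ℝ (Fin (n + 2)))
    (F := EuclideanSpace ℝ (Fin (n + 2))) (G := ℝ) (g.val (φ.symm z))
    (mfderiv (𝓡 (n + 2)) (𝓡 (n + 2)) φ.symm z) (mfderiv (𝓡 (n + 2)) (𝓡 (n + 2)) φ.symm z)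

variable (g : LorentzMetric n M) {φ : OpenPartialHomeomorph M (EuclideanSpace ℝ (Fin (n + 2)))}

theorem metricInChart_apply (z v w : EuclideanSpace ℝ (Fin (n + 2))) :
    g.metricInChart φ z v w = g.inChart φ z v w := rfl

theorem metricInChart_symm (z v w : EuclideanSpace ℝ (Fin (n + 2))) :
    g.metricInChart φ z v w = g.metricInChart φ z w v :=
  g.symm _ _ _

theorem val_eq_metricInChart (hφ : φ ∈ IsManifold.maximalAtlas (𝓡 (n + 2)) ∞ M) {y : M}
    (hy : y ∈ φ.source) (v w : TangentSpace (𝓡 (n + 2)) y) :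
    g.val y v w = g.metricInChart φ (φ y) (chartDiff φ y v) (chartDiff φ y w) := by
  have h := (OpenPartialHomeomorph.mDifferentiable_of_mem_maximalAtlas hφ).symm_comp_deriv hy
  have h1 : ∀ v, mfderiv (𝓡 (n + 2)) (𝓡 (n + 2)) φ.symm (φ y) (chartDiff φ y v) = v := fun v ↦
    congrArg (fun B ↦ B v) h
  rw [metricInChart_apply]
  unfold inChart
  rw [h1, h1, φ.left_inv hy]

theorem metricInChart_nondegenerate (hφ : φ ∈ IsManifold.maximalAtlas (𝓡 (n + 2)) ∞ M)
    {z : EuclideanSpace ℝ (Fin (n + 2))} (hz : z ∈ φ.target) {v : EuclideanSpace ℝ (Fin (n + 2))}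
    (h : ∀ w, g.metricInChart φ z v w = 0) : v = 0 := by
  have hm := OpenPartialHomeomorph.mDifferentiable_of_mem_maximalAtlas hφ
  have hsurj := hm.symm.mfderiv_surjective (x := z) hz
  have hinj := hm.symm.mfderiv_injective (x := z) hz
  refine hinj (Eq.trans ?_ (map_zero _).symm)
  refine g.eq_zero_of_forall_val_eq_zero fun w ↦ ?_
  obtain ⟨w, rfl⟩ := hsurj w
  exact h w

theorem contDiffOn_metricInChart (hφ : φ ∈ IsManifold.maximalAtlas (𝓡 (n + 2)) ∞ M) :
    ContDiffOn ℝ ∞ (g.metricInChart φ) φ.target := by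
  rw [contDiffOn_clm_apply]
  intro v
  rw [contDiffOn_clm_apply]
  intro w
  have hsymm := contMDiffOn_symm_of_mem_maximalAtlas hφ
  have hI : IsManifold (𝓡 (n + 2)) 1 M := IsManifold.of_le (n := ∞) (by simp)
  -- coordinate vectors are smooth vector fields along the inverse chart
  have hvec : ∀ v : EuclideanSpace ℝ (Fin (n + 2)),
      ContMDiffOn (𝓡 (n + 2)) ((𝓡 (n + 2)).prod (𝓡 (n + 2))) ∞
        (fun z ↦ Bundle.TotalSpace.mk' (EuclideanSpace ℝ (Fin (n + 2)))
          (E := fun x : M ↦ TangentSpace (𝓡 (n + 2)) x) (φ.symm z)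
          (mfderiv (𝓡 (n + 2)) (𝓡 (n + 2)) φ.symm z v)) φ.target := by
    intro v
    have h1 := hsymm.contMDiffOn_tangentMapWithin (m := ∞) (by simp)
      φ.open_target.uniqueMDiffOn
    have h2 : ContMDiffOn (𝓡 (n + 2)) (𝓡 (n + 2)).tangent ∞
        (fun z : EuclideanSpace ℝ (Fin (n + 2)) ↦
          (⟨z, v⟩ : TangentBundle (𝓡 (n + 2)) (EuclideanSpace ℝ (Fin (n + 2))))) φ.target := by
      intro z _
      exact contMDiffWithinAt_vectorSpace_iff_contDiffWithinAt.2 contDiffWithinAt_const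
    refine (h1.comp h2 fun z hz ↦ hz).congr fun z hz ↦ ?_
    simp only [Function.comp_apply, tangentMapWithin]
    rw [mfderivWithin_of_isOpen φ.open_target hz]
  have h : ContMDiffOn (𝓡 (n + 2)) ((𝓡 (n + 2)).prod 𝓘(ℝ, ℝ)) ∞
      (fun z ↦ Bundle.TotalSpace.mk' ℝ (E := Bundle.Trivial M ℝ) (φ.symm z)
        (g.inChart φ z v w)) φ.target := by
    apply ContMDiffOn.clm_bundle_apply₂ (F₁ := EuclideanSpace ℝ (Fin (n + 2)))
      (F₂ := EuclideanSpace ℝ (Fin (n + 2)))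
    · exact g.contMDiff.comp_contMDiffOn hsymm
    · exact hvec v
    · exact hvec w
  intro z hz
  have h3 := h z hz
  simp only [Bundle.contMDiffWithinAt_totalSpace] at h3
  exact contMDiffWithinAt_iff_contDiffWithinAt.1 h3.2

end LorentzMetric

namespace CodimOneFoliation

variable {F : CodimOneFoliation n M} {g : LorentzMetric n M}
  {φ : OpenPartialHomeomorph M (EuclideanSpace ℝ (Fin (n + 2)))}

omit [IsManifold (𝓡 (n + 2)) ∞ M] in
/-- Coordinate vectors of a foliation chart with vanishing transverse component are tangent to the
leaves: moving along such a vector one stays in a plaque, so the transverse coordinates of all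
other foliation charts are constant too. -/
theorem mfderiv_symm_mem_tangentSpace (hφ : φ ∈ F.atlas) {z : EuclideanSpace ℝ (Fin (n + 2))}
    (hz : z ∈ φ.target) {v : EuclideanSpace ℝ (Fin (n + 2))} (hv : v 0 = 0) :
    (mfderiv (𝓡 (n + 2)) (𝓡 (n + 2)) φ.symm z v : TangentSpace (𝓡 (n + 2)) (φ.symm z))
      ∈ F.tangentSpace (φ.symm z) := by
  intro ψ hψ hx
  have hφm := OpenPartialHomeomorph.mDifferentiable_of_mem_maximalAtlas (F.subset_maximalAtlas hφ)
  have hψm := OpenPartialHomeomorph.mDifferentiable_of_mem_maximalAtlas (F.subset_maximalAtlas hψ)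
  have hcomp : chartDiff ψ (φ.symm z) (mfderiv (𝓡 (n + 2)) (𝓡 (n + 2)) φ.symm z v)
      = fderiv ℝ (ψ ∘ φ.symm) z v := by
    rw [← mfderiv_eq_fderiv]
    exact (mfderiv_comp_apply z (hψm.mdifferentiableAt hx) (hφm.mdifferentiableAt_symm hz) v).symm
  have hdiff : DifferentiableAt ℝ (ψ ∘ φ.symm) z :=
    ((hψm.mdifferentiableAt hx).comp z (hφm.mdifferentiableAt_symm hz)).differentiableAt
  obtain ⟨U, hU, hUc⟩ := F.compatible φ hφ ψ hψ (φ.symm z) ⟨φ.map_target hz, hx⟩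
  have hline : HasDerivAt (fun s : ℝ ↦ z + s • v) v 0 := by
    simpa using ((hasDerivAt_id (0 : ℝ)).smul_const v).const_add z
  have hline0 : z + (0 : ℝ) • v = z := by rw [zero_smul, add_zero]
  have hev : (fun s : ℝ ↦ (ψ ∘ φ.symm) (z + s • v) 0) =ᶠ[𝓝 0] fun _ ↦ ψ (φ.symm z) 0 := by
    have hc : ContinuousAt (fun s : ℝ ↦ z + s • v) 0 := hline.continuousAt
    have h1 : ∀ᶠ s : ℝ in 𝓝 0, z + s • v ∈ φ.target ∩ φ.symm ⁻¹' U := by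
      refine hc.eventually_mem ?_
      rw [hline0]
      exact inter_mem (φ.open_target.mem_nhds hz) ((φ.continuousAt_symm hz).preimage_mem_nhds hU)
    filter_upwards [h1] with s hs
    refine (hUc _ hs.2 _ (mem_of_mem_nhds hU)).1 ?_
    rw [φ.right_inv hs.1, φ.right_inv hz]
    simp [hv]
  rw [hcomp]
  have h1 : HasFDerivAt (ψ ∘ φ.symm) (fderiv ℝ (ψ ∘ φ.symm) z) (z + (0 : ℝ) • v) := by
    rw [hline0]
    exact hdiff.hasFDerivAt
  have h2 := (EuclideanSpace.proj (𝕜 := ℝ) (0 : Fin (n + 2))).hasFDerivAt.comp_hasDerivAt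
    (0 : ℝ) (h1.comp_hasDerivAt (0 : ℝ) hline)
  exact h2.unique ((hasDerivAt_const (0 : ℝ) (ψ (φ.symm z) 0)).congr_of_eventuallyEq hev)

/-- For a lightlike foliation the metric gradient `N` of the transverse coordinate of a foliation
chart is tangent to the leaves. -/
theorem IsLightlike.gradient_tangent (h : F.IsLightlike g) (hφ : φ ∈ F.atlas)
    {z : EuclideanSpace ℝ (Fin (n + 2))} (hz : z ∈ φ.target) {N : EuclideanSpace ℝ (Fin (n + 2))}
    (hN : ∀ w, g.metricInChart φ z N w = w 0) : N 0 = 0 := by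
  have hφM := F.subset_maximalAtlas hφ
  obtain ⟨w, hw, hw0, hdeg⟩ := h (φ.symm z)
  have hx := φ.map_target hz
  set a := chartDiff φ (φ.symm z) w with ha
  have ha0 : a 0 = 0 := hw φ hφ hx
  have hane : a ≠ 0 := by
    intro h0
    apply hw0
    have hinj := (OpenPartialHomeomorph.mDifferentiable_of_mem_maximalAtlas hφM).mfderiv_injective hx
    apply hinj
    rw [map_zero]
    exact h0
  have hdeg' : ∀ v : EuclideanSpace ℝ (Fin (n + 2)), v 0 = 0 → g.metricInChart φ z a v = 0 := by
    intro v hv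
    have h1 := hdeg _ (mfderiv_symm_mem_tangentSpace hφ hz hv)
    rw [g.val_eq_metricInChart hφM hx, φ.right_inv hz] at h1
    have h2 := (OpenPartialHomeomorph.mDifferentiable_of_mem_maximalAtlas hφM).comp_symm_deriv hz
    have h3 : chartDiff φ (φ.symm z) (mfderiv (𝓡 (n + 2)) (𝓡 (n + 2)) φ.symm z v) = v :=
      congrArg (fun B ↦ B v) h2
    rwa [h3] at h1
  -- the degenerate direction `a` is a nonzero multiple of the gradient
  set k := g.metricInChart φ z a (EuclideanSpace.single 0 1) with hk
  have hak : a = k • N := by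
    rw [← sub_eq_zero]
    refine g.metricInChart_nondegenerate hφM hz fun v ↦ ?_
    have h1 : v = (v - v 0 • EuclideanSpace.single 0 1) + v 0 • EuclideanSpace.single 0 1 := by abel
    have h2 : g.metricInChart φ z a v = v 0 * k := by
      conv_lhs => rw [h1]
      rw [map_add, map_smul, hdeg' _ (by simp), zero_add, smul_eq_mul]
    rw [map_sub, map_smul, sub_apply, smul_apply, h2, hN,
      smul_eq_mul]
    ring
  have hk0 : k ≠ 0 := fun h0 ↦ hane (by rw [hak, h0, zero_smul])
  have : k * N 0 = 0 := by
    rw [hak] at ha0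
    simpa using ha0
  exact (mul_eq_zero.1 this).resolve_left hk0

/-- For a totally geodesic foliation the metric gradient `N` of the transverse coordinate of a
foliation chart satisfies the Killing equation in all directions tangent to the leaves. -/
theorem IsTotallyGeodesic.killing [SecondCountableTopology M] (h : F.IsTotallyGeodesic g)
    (hφ : φ ∈ F.atlas) {N : EuclideanSpace ℝ (Fin (n + 2)) → EuclideanSpace ℝ (Fin (n + 2))}
    (hNs : ContDiffOn ℝ ∞ N φ.target) (hN : ∀ z ∈ φ.target, ∀ w, g.metricInChart φ z (N z) w = w 0)
    {z : EuclideanSpace ℝ (Fin (n + 2))} (hz : z ∈ φ.target)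
    {v : EuclideanSpace ℝ (Fin (n + 2))} (hv : v 0 = 0) :
    g.metricInChart φ z v (fderiv ℝ N z v)
      + 1 / 2 * fderiv ℝ (g.metricInChart φ) z (N z) v v = 0 := by
  have hφM := F.subset_maximalAtlas hφ
  have hG := g.contDiffOn_metricInChart hφM
  have hGd : ∀ z ∈ φ.target, DifferentiableAt ℝ (g.metricInChart φ) z := fun z hz ↦
    ((hG z hz).contDiffAt (φ.open_target.mem_nhds hz)).differentiableAt (by simp)
  obtain ⟨ε, c, hε, hc0, hcv, hc2, hc⟩ := exists_geodesic φ.open_target hG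
    (fun z hz v hv ↦ g.metricInChart_nondegenerate hφM hz hv) hz v
  have h0 : (0 : ℝ) ∈ Ioo (-ε) ε := ⟨by linarith, hε⟩
  have hcat : ∀ t ∈ Ioo (-ε) ε, ContDiffAt ℝ 2 c t := fun t ht ↦
    (hc2 t ht).contDiffAt (isOpen_Ioo.mem_nhds ht)
  set γ : ℝ → M := φ.symm ∘ c with hγ
  have hγc : ∀ t ∈ Ioo (-ε) ε, (φ ∘ γ) =ᶠ[𝓝 t] c := by
    intro t ht
    filter_upwards [isOpen_Ioo.mem_nhds ht] with s hs
    exact φ.right_inv (hc s hs).1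
  have hγ2 : ContMDiffOn 𝓘(ℝ, ℝ) (𝓡 (n + 2)) 2 γ (Ioo (-ε) ε) :=
    ((contMDiffOn_symm_of_mem_maximalAtlas hφM).of_le
      (WithTop.coe_le_coe.2 le_top)).comp hc2.contMDiffOn fun t ht ↦ (hc t ht).1
  have hgeo : g.IsGeodesicOn γ (Ioo (-ε) ε) := by
    refine ⟨hγ2, fun t ht ↦ ⟨φ, hφM, φ.map_target (hc t ht).1, fun w ↦ ?_⟩⟩
    rw [(hγc t ht).deriv.deriv_eq, (hγc t ht).deriv_eq, (hγc t ht).eq_of_nhds]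
    simp only [← LorentzMetric.metricInChart_apply]
    rw [fderiv_apply_apply (hGd _ (hc t ht).1), fderiv_apply_apply (hGd _ (hc t ht).1)]
    exact (hc t ht).2 w
  have hcv0 : deriv c 0 0 = 0 := by rw [hcv, hv]
  have hγ0 : (mfderiv 𝓘(ℝ, ℝ) (𝓡 (n + 2)) γ 0 (1 : ℝ) : TangentSpace (𝓡 (n + 2)) (γ 0))
      ∈ F.tangentSpace (γ 0) := by
    have h1 : mfderiv 𝓘(ℝ, ℝ) (𝓡 (n + 2)) γ 0 (1 : ℝ)
        = mfderiv (𝓡 (n + 2)) (𝓡 (n + 2)) φ.symm (c 0) (deriv c 0) := by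
      have h2 := mfderiv_comp_apply (I := 𝓘(ℝ, ℝ)) (I' := 𝓡 (n + 2)) (I'' := 𝓡 (n + 2)) (0 : ℝ)
        ((OpenPartialHomeomorph.mDifferentiable_of_mem_maximalAtlas
          hφM).mdifferentiableAt_symm (hc 0 h0).1)
        ((hcat 0 h0).differentiableAt (by simp)).mdifferentiableAt (1 : ℝ)
      rw [mfderiv_eq_fderiv] at h2
      exact h2
    rw [h1]
    exact mfderiv_symm_mem_tangentSpace hφ (hc 0 h0).1 hcv0
  have hleaf := h γ ε hε hgeo hγ0
  have hγcont : ∀ᶠ t in 𝓝 (0 : ℝ), ContinuousAt γ t := by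
    filter_upwards [isOpen_Ioo.mem_nhds h0] with t ht
    exact hγ2.continuousOn.continuousAt (isOpen_Ioo.mem_nhds ht)
  have hplaque := F.eventually_eq_of_eventually_mem_leaf hφ hγcont (φ.map_target (hc 0 h0).1) hleaf
  have hconst : ∀ᶠ t in 𝓝 (0 : ℝ), EuclideanSpace.proj (𝕜 := ℝ) (0 : Fin (n + 2)) (c t)
      = EuclideanSpace.proj (𝕜 := ℝ) (0 : Fin (n + 2)) (c 0) := by
    filter_upwards [hplaque, hγc 0 h0] with t ht ht'
    have h1 := (hγc 0 h0).eq_of_nhds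
    simp only [Function.comp_apply] at h1 ht'
    rw [← ht', ← h1]
    exact ht
  have hcd' : DifferentiableAt ℝ (deriv c) 0 := by
    have h1 : ContDiffOn ℝ 1 (deriv c) (Ioo (-ε) ε) :=
      hc2.deriv_of_isOpen isOpen_Ioo (by norm_num)
    exact ((h1 0 h0).contDiffAt (isOpen_Ioo.mem_nhds h0)).differentiableAt (by simp)
  have hcd : ∀ᶠ t in 𝓝 (0 : ℝ), DifferentiableAt ℝ c t := by
    filter_upwards [isOpen_Ioo.mem_nhds h0] with t ht
    exact (hcat t ht).differentiableAt (by simp)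
  have hfin := killing_of_geodesic φ.open_target hG (fun z _ ↦ g.metricInChart_symm z)
    (ℓ := EuclideanSpace.proj 0) hNs hN (hc 0 h0).1 hcd hcd' (hc 0 h0).2 hconst
  rwa [hcv, hc0] at hfin

end CodimOneFoliation

end ChartMetric

/-! ### Adapted coordinates -/

section Coordinates

variable {n : ℕ}

/-- The point of `ℝⁿ⁺²` with coordinates `(u, v, x¹, …, xⁿ)`: the inverse of `uvx`. -/
noncomputable def ofUVX (q : ℝ × ℝ × (Fin n → ℝ)) : EuclideanSpace ℝ (Fin (n + 2)) :=
  WithLp.toLp 2 (Fin.cons q.1 (Fin.cons q.2.1 q.2.2))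

theorem ofUVX_uvx (z : EuclideanSpace ℝ (Fin (n + 2))) : ofUVX (uvx z) = z := by
  ext i
  refine Fin.cases rfl (fun i ↦ ?_) i
  exact Fin.cases rfl (fun i ↦ rfl) i

theorem contDiff_ofUVX : ContDiff ℝ ∞ (ofUVX (n := n)) := by
  rw [contDiff_euclidean]
  intro i
  refine Fin.cases contDiff_fst (fun i ↦ ?_) i
  refine Fin.cases (contDiff_fst.comp contDiff_snd) (fun i ↦ ?_) i
  exact (contDiff_apply ℝ ℝ i).comp (contDiff_snd.comp contDiff_snd)

theorem ofUVX_ux_zero (z : EuclideanSpace ℝ (Fin (n + 2))) :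
    ofUVX ((ux z).1, 0, (ux z).2) = z - z 1 • EuclideanSpace.single 1 1 := by
  ext i
  refine Fin.cases ?_ (fun i ↦ ?_) i
  · simp [ofUVX, ux]
  · refine Fin.cases ?_ (fun i ↦ ?_) i
    · simp [ofUVX]
    · have : (i.succ.succ : Fin (n + 2)) ≠ 1 := by
        rw [← Fin.succ_zero_eq_one, Ne, Fin.succ_inj]
        exact Fin.succ_ne_zero i
      simp [ofUVX, ux, this]

theorem norm_sub_single_le (z : EuclideanSpace ℝ (Fin (n + 2))) (j : Fin (n + 2)) :
    ‖z - z j • EuclideanSpace.single j 1‖ ≤ ‖z‖ := by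
  rw [EuclideanSpace.norm_eq, EuclideanSpace.norm_eq]
  refine Real.sqrt_le_sqrt (Finset.sum_le_sum fun i _ ↦ ?_)
  by_cases hi : i = j
  · subst hi
    simp
    positivity
  · simp [hi]

/-- The expansion of a symmetric bilinear form `B` with `B(∂_v, ·) = du`. -/
theorem bilinear_expansion
    {B : EuclideanSpace ℝ (Fin (n + 2)) →L[ℝ] EuclideanSpace ℝ (Fin (n + 2)) →L[ℝ] ℝ}
    (hsymm : ∀ a b, B a b = B b a) (hB : ∀ a, B (EuclideanSpace.single 1 1) a = a 0)
    (a : EuclideanSpace ℝ (Fin (n + 2))) :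
    B a a = 2 * a 0 * a 1
      + B (EuclideanSpace.single 0 1) (EuclideanSpace.single 0 1) * a 0 ^ 2
      + ∑ i : Fin n, 2 * B (EuclideanSpace.single 0 1) (EuclideanSpace.single i.succ.succ 1)
          * a 0 * a i.succ.succ
      + ∑ i : Fin n, ∑ j : Fin n,
          B (EuclideanSpace.single i.succ.succ 1) (EuclideanSpace.single j.succ.succ 1)
            * a i.succ.succ * a j.succ.succ := by
  set e : Fin (n + 2) → EuclideanSpace ℝ (Fin (n + 2)) := fun i ↦ EuclideanSpace.single i 1 with he
  set s : EuclideanSpace ℝ (Fin (n + 2)) := ∑ i : Fin n, a i.succ.succ • e i.succ.succ with hs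
  have ha : a = a 0 • e 0 + (a 1 • e 1 + s) := by
    have h1 : a = ∑ i, a i • e i := by
      ext j
      simp [he, Finset.sum_apply, Pi.single_apply]
    conv_lhs => rw [h1]
    rw [Fin.sum_univ_succ, Fin.sum_univ_succ]
    rfl
  have hs0 : s 0 = 0 := by
    simp only [hs, he, WithLp.ofLp_sum, Finset.sum_apply]
    refine Finset.sum_eq_zero fun i _ ↦ ?_
    simp [(Fin.succ_ne_zero i.succ).symm]
  have h11 : B (e 1) (e 1) = 0 := by rw [hB]; simp [he]
  have h10 : B (e 1) (e 0) = 1 := by rw [hB]; simp [he]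
  have h1s : B (e 1) s = 0 := by rw [hB, hs0]
  have h0s : B (e 0) s = ∑ i : Fin n, a i.succ.succ * B (e 0) (e i.succ.succ) := by
    simp [hs]
  have hss : B s s = ∑ i : Fin n, ∑ j : Fin n,
      B (e i.succ.succ) (e j.succ.succ) * a i.succ.succ * a j.succ.succ := by
    have hBs : ∀ x, B s x = ∑ i : Fin n, a i.succ.succ * B (e i.succ.succ) x := by
      intro x
      rw [hs]
      simp
    rw [hBs]
    refine Finset.sum_congr rfl fun i _ ↦ ?_
    rw [hs, map_sum, Finset.mul_sum]
    refine Finset.sum_congr rfl fun j _ ↦ ?_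
    rw [map_smul, smul_eq_mul]
    ring
  have hW : ∑ i : Fin n, 2 * B (e 0) (e i.succ.succ) * a 0 * a i.succ.succ
      = 2 * a 0 * B (e 0) s := by
    rw [h0s, Finset.mul_sum]
    exact Finset.sum_congr rfl fun i _ ↦ by ring
  change _ = 2 * a 0 * a 1 + B (e 0) (e 0) * a 0 ^ 2
    + ∑ i : Fin n, 2 * B (e 0) (e i.succ.succ) * a 0 * a i.succ.succ
    + ∑ i : Fin n, ∑ j : Fin n, B (e i.succ.succ) (e j.succ.succ) * a i.succ.succ * a j.succ.succ
  rw [hW, ← hss]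
  conv_lhs => rw [ha]
  simp only [map_add, map_smul, add_apply, smul_apply, smul_eq_mul, h11, h10, h1s,
    hsymm (e 0) (e 1), hsymm s (e 0), hsymm s (e 1)]
  ring

end Coordinates

section AdaptedChart

variable {n : ℕ} {M : Type*} [TopologicalSpace M]
  [ChartedSpace (EuclideanSpace ℝ (Fin (n + 2))) M] [IsManifold (𝓡 (n + 2)) ∞ M]

/-- Reparametrizing a foliation chart by a diffeomorphism of a ball that only translates the
transverse coordinate gives an adapted chart. -/
theorem CodimOneFoliation.isAdaptedChart_trans {F : CodimOneFoliation n M}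
    {φ : OpenPartialHomeomorph M (EuclideanSpace ℝ (Fin (n + 2)))} (hφ : φ ∈ F.atlas)
    {Ψ : OpenPartialHomeomorph (EuclideanSpace ℝ (Fin (n + 2))) (EuclideanSpace ℝ (Fin (n + 2)))}
    {r : ℝ} (hΨs : Ψ.source = Metric.ball 0 r) (hΨt : Ψ.target ⊆ φ.target)
    (hΨ : ContDiffOn ℝ ∞ Ψ Ψ.source) (hΨ' : ContDiffOn ℝ ∞ Ψ.symm Ψ.target) {k : ℝ}
    (hΨ0 : ∀ z ∈ Ψ.source, Ψ z 0 = z 0 + k) : F.IsAdaptedChart (φ.trans Ψ.symm) := by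
  have hφM := F.subset_maximalAtlas hφ
  have hmaps : MapsTo Ψ Ψ.source φ.target := fun z hz ↦ hΨt (Ψ.map_source hz)
  have htarget : (φ.trans Ψ.symm).target = Ψ.source := by
    rw [OpenPartialHomeomorph.trans_target]
    exact inter_eq_left.2 fun z hz ↦ hmaps hz
  have hcoord : ∀ y ∈ (φ.trans Ψ.symm).source, φ y 0 = (φ.trans Ψ.symm) y 0 + k := by
    intro y hy
    rw [OpenPartialHomeomorph.trans_source] at hy
    have h1 := hΨ0 _ (Ψ.map_target hy.2)
    rw [Ψ.right_inv hy.2] at h1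
    exact h1
  refine ⟨?_, fun c ↦ ?_, fun ψ hψ x hx ↦ ?_⟩
  · apply OpenPartialHomeomorph.mem_maximalAtlas_of_contMDiffOn
    · rw [OpenPartialHomeomorph.trans_source]
      exact hΨ'.contMDiffOn.comp ((contMDiffOn_of_mem_maximalAtlas hφM).mono inter_subset_left)
        fun y hy ↦ hy.2
    · rw [htarget]
      exact (contMDiffOn_symm_of_mem_maximalAtlas hφM).comp hΨ.contMDiffOn hmaps
  · have hset : {y | y ∈ (φ.trans Ψ.symm).source ∧ (φ.trans Ψ.symm) y 0 = c}
        = (φ.trans Ψ.symm).symm '' (Metric.ball 0 r ∩ {z | z 0 = c}) := by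
      rw [← hΨs, ← htarget]
      ext y
      constructor
      · rintro ⟨hy, hyc⟩
        exact ⟨_, ⟨OpenPartialHomeomorph.map_source _ hy, hyc⟩,
          OpenPartialHomeomorph.left_inv _ hy⟩
      · rintro ⟨z, ⟨hz, hzc⟩, rfl⟩
        refine ⟨OpenPartialHomeomorph.map_target _ hz, ?_⟩
        rw [OpenPartialHomeomorph.right_inv _ hz]
        exact hzc
    rw [hset]
    have hconv : Convex ℝ {z : EuclideanSpace ℝ (Fin (n + 2)) | z 0 = c} :=
      convex_hyperplane (EuclideanSpace.proj (𝕜 := ℝ) (0 : Fin (n + 2))).toLinearMap.isLinear c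
    refine ((convex_ball _ r).inter hconv).isPreconnected.image _ ?_
    refine (φ.trans Ψ.symm).continuousOn_symm.mono fun z hz ↦ ?_
    rw [htarget, hΨs]
    exact hz.1
  · have hxφ : x ∈ φ.source := hx.1.1
    obtain ⟨U, hU, hUc⟩ := F.compatible φ hφ ψ hψ x ⟨hxφ, hx.2⟩
    refine ⟨U ∩ (φ.trans Ψ.symm).source,
      inter_mem hU ((φ.trans Ψ.symm).open_source.mem_nhds hx.1), fun y hy z hz ↦ ?_⟩
    rw [← hUc y hy.1 z hz.1, hcoord y hy.2, hcoord z hz.2, add_left_inj]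

/-- The metric in the coordinates `Ψ⁻¹ ∘ φ`, where `Ψ` parametrizes part of the chart `φ`. -/
theorem LorentzMetric.val_eq_pullback (g : LorentzMetric n M)
    {φ : OpenPartialHomeomorph M (EuclideanSpace ℝ (Fin (n + 2)))}
    (hφ : φ ∈ IsManifold.maximalAtlas (𝓡 (n + 2)) ∞ M)
    {Ψ : OpenPartialHomeomorph (EuclideanSpace ℝ (Fin (n + 2))) (EuclideanSpace ℝ (Fin (n + 2)))}
    (hΨ : ContDiffOn ℝ ∞ Ψ Ψ.source) (hΨ' : ContDiffOn ℝ ∞ Ψ.symm Ψ.target) {y : M}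
    (hy : y ∈ (φ.trans Ψ.symm).source) (w : TangentSpace (𝓡 (n + 2)) y) :
    g.val y w w = g.metricInChart φ (Ψ ((φ.trans Ψ.symm) y))
      (fderiv ℝ Ψ ((φ.trans Ψ.symm) y) (chartDiff (φ.trans Ψ.symm) y w))
      (fderiv ℝ Ψ ((φ.trans Ψ.symm) y) (chartDiff (φ.trans Ψ.symm) y w)) := by
  set χ := φ.trans Ψ.symm with hχ
  have hy' := hy
  rw [hχ, OpenPartialHomeomorph.trans_source] at hy'
  have hχy : χ y ∈ Ψ.source := Ψ.map_target hy'.2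
  have hΨχ : Ψ (χ y) = φ y := Ψ.right_inv hy'.2
  have hφd := (OpenPartialHomeomorph.mDifferentiable_of_mem_maximalAtlas hφ).mdifferentiableAt hy'.1
  have hΨd : DifferentiableAt ℝ Ψ (χ y) :=
    ((hΨ _ hχy).contDiffAt (Ψ.open_source.mem_nhds hχy)).differentiableAt (by simp)
  have hΨd' : DifferentiableAt ℝ Ψ.symm (φ y) :=
    ((hΨ' _ hy'.2).contDiffAt (Ψ.open_target.mem_nhds hy'.2)).differentiableAt (by simp)
  have hd : chartDiff φ y w = fderiv ℝ Ψ (χ y) (chartDiff χ y w) := by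
    have h1 : chartDiff χ y w = fderiv ℝ Ψ.symm (φ y) (chartDiff φ y w) := by
      have := mfderiv_comp_apply (I := 𝓡 (n + 2)) (I' := 𝓡 (n + 2)) (I'' := 𝓡 (n + 2)) y
        hΨd'.mdifferentiableAt hφd w
      rw [mfderiv_eq_fderiv] at this
      exact this
    have h2 : HasFDerivAt (Ψ ∘ Ψ.symm) ((fderiv ℝ Ψ (χ y)).comp (fderiv ℝ Ψ.symm (φ y))) (φ y) :=
      HasFDerivAt.comp (φ y) hΨd.hasFDerivAt hΨd'.hasFDerivAt
    have h3 : (Ψ ∘ Ψ.symm) =ᶠ[𝓝 (φ y)] id := by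
      filter_upwards [Ψ.open_target.mem_nhds hy'.2] with z hz
      exact Ψ.right_inv hz
    have h4 := (h2.congr_of_eventuallyEq h3.symm).unique (hasFDerivAt_id (φ y))
    rw [h1]
    exact (congrArg (fun B ↦ B (chartDiff φ y w)) h4).symm
  rw [g.val_eq_metricInChart hφ hy'.1, hΨχ, hd]

end AdaptedChart

section NormalForm

variable {n : ℕ} {T : Set (EuclideanSpace ℝ (Fin (n + 2)))}
  {G : EuclideanSpace ℝ (Fin (n + 2)) →
    EuclideanSpace ℝ (Fin (n + 2)) →L[ℝ] EuclideanSpace ℝ (Fin (n + 2)) →L[ℝ] ℝ}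
  {N : EuclideanSpace ℝ (Fin (n + 2)) → EuclideanSpace ℝ (Fin (n + 2))}

/-- The normal form of a metric `G` on an open set of `ℝⁿ⁺²` whose gradient field `N` of the `0`-th
coordinate `u` is tangent to the level sets of `u` and satisfies the Killing equation along them.
In coordinates with `N = ∂_v` the relation `G(N, ·) = du` gives the coefficients of
`dv², dv dxⁱ, du dv`, and the Killing equation makes the leafwise coefficients independent of
`v`. -/
theorem exists_normalForm (hT : IsOpen T) (hG : ContDiffOn ℝ ∞ G T)
    (hGsymm : ∀ z v w, G z v w = G z w v) (hN : ContDiffOn ℝ ∞ N T)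
    (hGN : ∀ z ∈ T, ∀ w, G z (N z) w = w 0) (hN0 : ∀ z ∈ T, N z 0 = 0)
    (hK : ∀ z ∈ T, ∀ v : EuclideanSpace ℝ (Fin (n + 2)), v 0 = 0 →
      G z v (fderiv ℝ N z v) + 1 / 2 * fderiv ℝ G z (N z) v v = 0)
    {p : EuclideanSpace ℝ (Fin (n + 2))} (hp : p ∈ T) :
    ∃ (Ψ : OpenPartialHomeomorph (EuclideanSpace ℝ (Fin (n + 2)))
        (EuclideanSpace ℝ (Fin (n + 2)))) (r : ℝ), 0 < r ∧ Ψ.source = Metric.ball 0 r ∧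
      Ψ 0 = p ∧ Ψ.target ⊆ T ∧ ContDiffOn ℝ ∞ Ψ Ψ.source ∧ ContDiffOn ℝ ∞ Ψ.symm Ψ.target ∧
      (∀ z ∈ Ψ.source, Ψ z 0 = z 0 + p 0) ∧
      ∃ (H : ℝ × ℝ × (Fin n → ℝ) → ℝ) (W : Fin n → ℝ × ℝ × (Fin n → ℝ) → ℝ)
        (h : Fin n → Fin n → ℝ × (Fin n → ℝ) → ℝ),
        ContDiffOn ℝ ∞ H (uvx '' Ψ.source) ∧
        (∀ i, ContDiffOn ℝ ∞ (W i) (uvx '' Ψ.source)) ∧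
        (∀ i j, ContDiffOn ℝ ∞ (h i j) (ux '' Ψ.source)) ∧
        (∀ i j, h i j = h j i) ∧
        ∀ z ∈ Ψ.source, ∀ a, G (Ψ z) (fderiv ℝ Ψ z a) (fderiv ℝ Ψ z a)
          = 2 * a 0 * a 1 + H (uvx z) * a 0 ^ 2
            + ∑ i : Fin n, W i (uvx z) * a 0 * a i.succ.succ
            + ∑ i : Fin n, ∑ j : Fin n, h i j (ux z) * a i.succ.succ * a j.succ.succ := by
  have hNp : N p ≠ 0 := by
    intro h0
    have h1 := hGN p hp (EuclideanSpace.single 0 1)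
    rw [h0] at h1
    simp at h1
  obtain ⟨Ψ, r, hr, hΨs, hΨp, hΨt, hΨ, hΨ', hΨN⟩ := exists_flowBox hT hN hN0 hp hNp
  have hmaps : MapsTo Ψ Ψ.source T := fun z hz ↦ hΨt (Ψ.map_source hz)
  have hΨd : ∀ z ∈ Ψ.source, DifferentiableAt ℝ Ψ z := fun z hz ↦
    ((hΨ z hz).contDiffAt (Ψ.open_source.mem_nhds hz)).differentiableAt (by simp)
  let ℓ : EuclideanSpace ℝ (Fin (n + 2)) →L[ℝ] ℝ := EuclideanSpace.proj 0
  have hΨ0 : ∀ z ∈ Ψ.source, ∀ v, fderiv ℝ Ψ z v 0 = v 0 := by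
    intro z hz v
    have h1 := ℓ.hasFDerivAt.comp z (hΨd z hz).hasFDerivAt
    have h2 : (ℓ ∘ Ψ) =ᶠ[𝓝 z] fun z ↦ ℓ z + p 0 := by
      filter_upwards [Ψ.open_source.mem_nhds hz] with y hy
      exact (hΨN y hy).1
    have h3 := h1.unique ((ℓ.hasFDerivAt.add_const (p 0)).congr_of_eventuallyEq h2)
    exact congrArg (fun B ↦ B v) h3
  -- the coefficients of the metric in the new coordinates
  let K : EuclideanSpace ℝ (Fin (n + 2)) → EuclideanSpace ℝ (Fin (n + 2)) →
      EuclideanSpace ℝ (Fin (n + 2)) → ℝ :=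
    fun a b z ↦ G (Ψ z) (fderiv ℝ Ψ z a) (fderiv ℝ Ψ z b)
  have hKs : ∀ a b, ContDiffOn ℝ ∞ (K a b) (Metric.ball 0 r) := by
    intro a b
    rw [← hΨs]
    have hdΨ : ContDiffOn ℝ ∞ (fderiv ℝ Ψ) Ψ.source :=
      hΨ.fderiv_of_isOpen Ψ.open_source (by simp)
    exact ((hG.comp hΨ hmaps).clm_apply (hdΨ.clm_apply contDiffOn_const)).clm_apply
      (hdΨ.clm_apply contDiffOn_const)
  have hKsymm : ∀ a b, K a b = K b a := fun a b ↦ funext fun z ↦ hGsymm _ _ _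
  have hK1 : ∀ z ∈ Ψ.source, ∀ a, K (EuclideanSpace.single 1 1) a z = a 0 := by
    intro z hz a
    change G (Ψ z) (fderiv ℝ Ψ z (EuclideanSpace.single 1 1)) (fderiv ℝ Ψ z a) = a 0
    rw [(hΨN z hz).2, hGN _ (hmaps hz), hΨ0 z hz]
  -- the Killing equation: leafwise coefficients do not change along `∂_v`
  have hKderiv : ∀ a b : EuclideanSpace ℝ (Fin (n + 2)), a 0 = 0 → b 0 = 0 → ∀ z ∈ Ψ.source,
      fderiv ℝ (K a b) z (EuclideanSpace.single 1 1) = 0 := by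
    intro a b ha hb z hz
    refine fderiv_pullback_eq_zero hT hG hN Ψ.open_source hΨ hmaps
      (fun z hz ↦ (hΨN z hz).2) hz ?_
    refine killing_polarization hT hG (fun z _ ↦ hGsymm z) (ℓ := ℓ) (hmaps hz)
      (hK _ (hmaps hz)) ?_ ?_
    · exact (hΨ0 z hz a).trans ha
    · exact (hΨ0 z hz b).trans hb
  have hKconst : ∀ a b : EuclideanSpace ℝ (Fin (n + 2)), a 0 = 0 → b 0 = 0 →
      ∀ z ∈ Metric.ball (0 : EuclideanSpace ℝ (Fin (n + 2))) r,
      K a b z = K a b (z - z 1 • EuclideanSpace.single 1 1) := by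
    intro a b ha hb z hz
    have hz' : z - z 1 • EuclideanSpace.single (1 : Fin (n + 2)) (1 : ℝ) ∈
        Metric.ball (0 : EuclideanSpace ℝ (Fin (n + 2))) r := by
      rw [mem_ball_zero_iff] at hz ⊢
      exact (norm_sub_single_le z 1).trans_lt hz
    obtain ⟨y, hy, hyeq⟩ := domain_mvt (f := K a b) (f' := fderiv ℝ (K a b))
      (fun y hy ↦ (((hKs a b y hy).contDiffAt (Metric.isOpen_ball.mem_nhds hy)).differentiableAt
        (by simp)).hasFDerivAt.hasFDerivWithinAt) (convex_ball _ r) hz' hz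
    rw [sub_sub_cancel, map_smul,
      hKderiv a b ha hb y (hΨs ▸ (convex_ball _ r).segment_subset hz' hz hy), smul_zero] at hyeq
    exact sub_eq_zero.1 hyeq
  -- `h_ij` is read off on the slice `v = 0`; the projection to it maps the ball into itself
  have huvx : MapsTo ofUVX (uvx '' Metric.ball (0 : EuclideanSpace ℝ (Fin (n + 2))) r)
      (Metric.ball 0 r) := by
    rintro _ ⟨z, hz, rfl⟩
    rwa [ofUVX_uvx]
  have hux : MapsTo (fun q : ℝ × (Fin n → ℝ) ↦ ofUVX (q.1, 0, q.2))
      (ux '' Metric.ball (0 : EuclideanSpace ℝ (Fin (n + 2))) r) (Metric.ball 0 r) := by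
    rintro _ ⟨z, hz, rfl⟩
    change ofUVX ((ux z).1, 0, (ux z).2) ∈ _
    rw [ofUVX_ux_zero]
    rw [mem_ball_zero_iff] at hz ⊢
    exact (norm_sub_single_le z 1).trans_lt hz
  have hslice : ContDiff ℝ ∞ (fun q : ℝ × (Fin n → ℝ) ↦ ofUVX (q.1, 0, q.2)) :=
    contDiff_ofUVX.comp (contDiff_fst.prodMk (contDiff_const.prodMk contDiff_snd))
  refine ⟨Ψ, r, hr, hΨs, hΨp, hΨt, hΨ, hΨ', fun z hz ↦ (hΨN z hz).1,
    fun q ↦ K (EuclideanSpace.single 0 1) (EuclideanSpace.single 0 1) (ofUVX q),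
    fun i q ↦ 2 * K (EuclideanSpace.single 0 1) (EuclideanSpace.single i.succ.succ 1) (ofUVX q),
    fun i j q ↦ K (EuclideanSpace.single i.succ.succ 1) (EuclideanSpace.single j.succ.succ 1)
      (ofUVX (q.1, 0, q.2)), ?_, ?_, ?_, fun i j ↦ ?_, fun z hz a ↦ ?_⟩
  · rw [hΨs]
    exact (hKs _ _).comp contDiff_ofUVX.contDiffOn huvx
  · rw [hΨs]
    exact fun i ↦ contDiffOn_const.mul ((hKs _ _).comp contDiff_ofUVX.contDiffOn huvx)
  · rw [hΨs]
    exact fun i j ↦ (hKs _ _).comp hslice.contDiffOn hux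
  · funext q
    exact congrFun (hKsymm _ _) _
  · let B : EuclideanSpace ℝ (Fin (n + 2)) →L[ℝ] EuclideanSpace ℝ (Fin (n + 2)) →L[ℝ] ℝ :=
      (G (Ψ z)).bilinearComp (fderiv ℝ Ψ z) (fderiv ℝ Ψ z)
    have hB : ∀ a b, B a b = K a b z := fun a b ↦ rfl
    have hexp := bilinear_expansion (B := B)
      (fun a b ↦ by rw [hB, hB, hKsymm]) (fun a ↦ by rw [hB, hK1 z hz]) a
    simp only [hB] at hexp
    change K a a z = _
    rw [hexp]
    simp only [ofUVX_uvx, ofUVX_ux_zero]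
    congr 1
    refine Finset.sum_congr rfl fun i _ ↦ Finset.sum_congr rfl fun j _ ↦ ?_
    rw [hKconst _ _ (by simp [(Fin.succ_ne_zero _).symm]) (by simp [(Fin.succ_ne_zero _).symm])
      z (hΨs ▸ hz)]

end NormalForm

theorem mainTheorem5 (n : ℕ) (M : Type*) [TopologicalSpace M] [T2Space M]
    [SecondCountableTopology M] [ChartedSpace (EuclideanSpace ℝ (Fin (n + 2))) M]
    [IsManifold (𝓡 (n + 2)) ∞ M] (g : LorentzMetric n M) (F : CodimOneFoliation n M)
    (hlight : F.IsLightlike g) (hgeod : F.IsTotallyGeodesic g) (p : M) :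
    ∃ φ : OpenPartialHomeomorph M (EuclideanSpace ℝ (Fin (n + 2))),
      p ∈ φ.source ∧ F.IsAdaptedChart φ ∧
      ∃ (H : ℝ × ℝ × (Fin n → ℝ) → ℝ) (W : Fin n → ℝ × ℝ × (Fin n → ℝ) → ℝ)
        (h : Fin n → Fin n → ℝ × (Fin n → ℝ) → ℝ),
        ContDiffOn ℝ ∞ H (uvx '' φ.target) ∧
        (∀ i, ContDiffOn ℝ ∞ (W i) (uvx '' φ.target)) ∧
        (∀ i j, ContDiffOn ℝ ∞ (h i j) (ux '' φ.target)) ∧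
        (∀ i j, h i j = h j i) ∧
        ∀ y ∈ φ.source, ∀ w : TangentSpace (𝓡 (n + 2)) y,
          let du : ℝ := chartDiff φ y w 0
          let dv : ℝ := chartDiff φ y w 1
          let dx : Fin n → ℝ := fun i ↦ chartDiff φ y w i.succ.succ
          g.val y w w = 2 * du * dv + H (uvx (φ y)) * du ^ 2
            + ∑ i, W i (uvx (φ y)) * du * dx i
            + ∑ i, ∑ j, h i j (ux (φ y)) * dx i * dx j := by
  obtain ⟨φ, hφ, hpφ⟩ := F.cover p
  have hφM := F.subset_maximalAtlas hφ
  set G := g.metricInChart φ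
  have hG : ContDiffOn ℝ ∞ G φ.target := g.contDiffOn_metricInChart hφM
  have hGsymm : ∀ z v w, G z v w = G z w v := g.metricInChart_symm
  have hnd : ∀ z ∈ φ.target, ∀ v, (∀ w, G z v w = 0) → v = 0 :=
    fun z hz v hv ↦ g.metricInChart_nondegenerate hφM hz hv
  -- the gradient of the transverse coordinate
  let ℓ : EuclideanSpace ℝ (Fin (n + 2)) →L[ℝ] ℝ := EuclideanSpace.proj 0
  let N : EuclideanSpace ℝ (Fin (n + 2)) → EuclideanSpace ℝ (Fin (n + 2)) :=
    fun z ↦ (G z).inverse ℓ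
  have hN : ContDiffOn ℝ ∞ N φ.target := (contDiffOn_inverse hG hnd).clm_apply contDiffOn_const
  have hGN : ∀ z ∈ φ.target, ∀ w, G z (N z) w = w 0 := fun z hz w ↦
    congrArg (fun B ↦ B w) (apply_inverse_of_nondegenerate (hnd z hz) ℓ)
  have hN0 : ∀ z ∈ φ.target, N z 0 = 0 := fun z hz ↦ hlight.gradient_tangent hφ hz (hGN z hz)
  obtain ⟨Ψ, r, hr, hΨs, hΨp, hΨt, hΨ, hΨ', hΨ0, H, W, h, hH, hW, hh, hhsymm, hform⟩ :=
    exists_normalForm φ.open_target hG hGsymm hN hGN hN0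
      (fun z hz v hv ↦ hgeod.killing hφ hN hGN hz hv) (φ.map_source hpφ)
  have htarget : (φ.trans Ψ.symm).target = Ψ.source := by
    rw [OpenPartialHomeomorph.trans_target]
    exact inter_eq_left.2 fun z hz ↦ hΨt (Ψ.map_source hz)
  refine ⟨φ.trans Ψ.symm, ?_, F.isAdaptedChart_trans hφ hΨs hΨt hΨ hΨ' hΨ0, H, W, h, ?_, ?_, ?_,
    hhsymm, fun y hy w ↦ ?_⟩
  · rw [OpenPartialHomeomorph.trans_source]
    refine ⟨hpφ, ?_⟩
    change φ p ∈ Ψ.target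
    rw [← hΨp]
    exact Ψ.map_source (hΨs ▸ Metric.mem_ball_self hr)
  · rwa [htarget]
  · rwa [htarget]
  · rwa [htarget]
  · intro du dv dx
    rw [g.val_eq_pullback hφM hΨ hΨ' hy w]
    exact hform _ (htarget ▸ OpenPartialHomeomorph.map_source _ hy) _
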